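/- Let $H$ be a finite-dimensional Hopf algebra over a field $k$, with comultiplication $\Delta(h)=h^{(1)}\otimes h^{(2)}$, counit $\varepsilon$ and antipode $\gamma$, and let $H^*$ be its dual, with product $\langle \eta\zeta,h\rangle=\langle\eta,h^{(1)}\rangle\langle\zeta,h^{(2)}\rangle$. Write $\langle \eta\leftharpoonup h,x\rangle=\langle\eta,hx\rangle$ for the right co-regular action of $H$ on $H^*$. Let $L$ be a base algebra over $H$: a unital associative algebra which is a left $H$-module algebra (action $\triangleright$) and a left $H$-comodule algebra (coaction $\lambda\mapsto\lambda^{(1)}\otimes\lambda^{[\infty]}\in H\otimes L$), such that the Yetter–Drinfeld condition $\delta(h\triangleright\lambda)=h^{(1)}\lambda^{(1)}\gamma(h^{(3)})\otimes h^{(2)}\triangleright\lambda^{[\infty]}$ and the braided commutativity $\lambda\mu=(\lambda^{(1)}\triangleright\mu)\lambda^{[\infty]}$ hold. Let $A$ be a unital dynamical algebra over $(H,L)$: a left $H$-module with an $H$-equivariant map $\divideontimes :A\otimes A\to A\otimes L$, which is associative in the shifted sense, i.e. the two maps $$A\otimes A\otimes A\xrightarrow{\divideontimes \otimes \mathrm{id}}A\otimes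 L\otimes A\to A\otimes A\otimes L\xrightarrow{\divideontimes \otimes\mathrm{id}}A\otimes L\otimes L\to A\otimes L,\qquad A\otimes A\otimes A\xrightarrow{\mathrm{id}\otimes\divideontimes }A\otimes A\otimes L\xrightarrow{\divideontimes \otimes\mathrm{id}}A\otimes L\otimes L\to A\otimes L$$ coincide, where $L\otimes A\to A\otimes L$ is $\lambda\otimes a\mapsto(\lambda^{(1)}\triangleright a)\otimes\lambda^{[\infty]}$ and $L\otimes L\to L$ is the multiplication, and with an element $1\in A$ such that $1\divideontimes a=a\divideontimes 1=a\otimes 1$. Let $B=A\rtimes L$ be the dynamical smash product: the associative algebra $A\otimes L$ with product $(a\lambda)(b\mu)=\bigl(a\divideontimes (\lambda^{(1)}\triangleright b)\bigr)\lambda^{[\infty]}\mu$. It contains $L$ as a subalgebra and $A$ as a subspace, and is an $H$-module algebra; let $b\mapsto b^{[0]}\otimes b^{\langle1\rangle}\in B\otimes H^*$ be the dual coaction, $h\triangleright b=b^{[0]}\langle b^{\langle1\rangle},h\rangle$. Let $\chi:L\to k$ be an invariant character, i.e. a unital algebra homomorphism with $\chi(h\triangleright\lambda)=\varepsilon(h)\chi(\lambda)$.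 Let $\tilde\chi:L\to k$ be the adjoint character $$\tilde\chi(\lambda)=\sum_i\chi\bigl(\eta^i\triangleright(\gamma(h_i)\triangleright\lambda)\bigr),\qquad \eta\triangleright\lambda=\langle\eta,\lambda^{(1)}\rangle\lambda^{[\infty]},$$ where $(h_i)$ is a basis of $H$ and $(\eta^i)$ the dual basis. Put $$A_\chi=B\otimes_Lk_\chi=B/\mathrm{Span}\{b\lambda-\chi(\lambda)b\},\qquad {}_{\tilde\chi}A=k_{\tilde\chi}\otimes_LB=B/\mathrm{Span}\{\lambda b-\tilde\chi(\lambda)b\}\qquad(b\in B,\ \lambda\in L),$$ a left and a right $B$-module. Let $I_\chi$ be the space of invariants $A^H=\{c\in A: h\triangleright c=\varepsilon(h)c\ \ \forall h\in H\}$, acting on $A_\chi$ from the right and on ${}_{\tilde\chi}A$ from the left by multiplication in $B$ (the action on $A_\chi$ sends the class of $a\in A$ to the class of $(\mathrm{id}\otimes\chi)(a\divideontimes c)$), and let $A_\chi\otimes_{I_\chi}{}_{\tilde\chi}A$ be the quotient of $A_\chi\otimes{}_{\tilde\chi}A$ by the span of the elements $xc\otimes y-x\otimes cy$, with the left and right actions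 of $B$ on the first and the second factor. Equip $B\otimes H^*$ with the $B$-bimodule structure $a.(b\otimes\eta).c=abc^{[0]}\otimes\eta c^{\langle1\rangle}$. Let $\iota_\chi:L\to H$, $\iota_\chi(\lambda)=\lambda^{(1)}\chi(\lambda^{[\infty]})$, let $\lambda\blacktriangleright\eta=\eta\leftharpoonup\gamma(\iota_\chi(\lambda))$, and let $J_\chi$ be the span of the elements $b\lambda\otimes\eta-b\otimes(\lambda\blacktriangleright\eta)$ with $b\in B$, $\lambda\in L$, $\eta\in H^*$. It is a sub-bimodule; denote by $A\otimes_\chi H^*$ the quotient bimodule $(B\otimes H^*)/J_\chi$, and by $\mathrm P_\chi$ the projection onto it. Finally let $\check\Gamma:B\otimes B\to B\otimes H^*$, $\check\Gamma(a\otimes b)=ab^{[0]}\otimes b^{\langle1\rangle}$. **Theorem.** There is a $B$-bimodule homomorphism $$\Gamma_\chi:A_\chi\otimes_{I_\chi}{}_{\tilde\chi}A\to A\otimes_\chi H^*$$ whose composition with the natural projection $B\otimes B\to A_\chi\otimes_{I_\chi}{}_{\tilde\chi}A$ is $\mathrm P_\chi\circ\check\Gamma$, and it is the only linear map with this property. The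 natural map $A\otimes H^*\to A\otimes_\chi H^*$, $a\otimes\eta\mapsto\mathrm P_\chi(a\otimes\eta)$, is a linear isomorphism. If $\divideontimes $ has the form $a\divideontimes b=ab\otimes1$ for an ordinary multiplication $A\otimes A\to A$, then under this isomorphism $\Gamma_\chi$ sends the class of $a\otimes b$, with $a,b\in A$, to $ab^{[0]}\otimes b^{\langle1\rangle}$; that is, $\Gamma_\chi$ is given by the formula of the ordinary Hopf–Galois map of $A$. -/

import Mathlib

open TensorProduct

namespace DynSmash

section Actions

variable {k H V W : Type*} [Field k] [Ring H] [HopfAlgebra k H]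
  [AddCommGroup V] [Module k V] [AddCommGroup W] [Module k W]

/-- The action `h ▷ (v ⊗ w) = (h⁽¹⁾ ▷ v) ⊗ (h⁽²⁾ ▷ w)` of a Hopf algebra on the tensor product of two
modules. A left `H`-module structure on a vector space `V` is an algebra map `H → End V`. -/
noncomputable def tensorAct (ρ : H →ₐ[k] Module.End k V) (σ : H →ₐ[k] Module.End k W) :
    H →ₐ[k] Module.End k (V ⊗[k] W) :=
  (Module.endTensorEndAlgHom (R := k) (S := k) (A := k) (M := V) (N := W)).comp
    ((Algebra.TensorProduct.map ρ σ).comp (Bialgebra.comulAlgHom k H))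

/-- For a coaction `δ : L → H ⊗ L`, `δ l = l⁽¹⁾ ⊗ l^[∞]`, and an `H`-module `V`, the permutation
`L ⊗ V → V ⊗ L`, `l ⊗ v ↦ (l⁽¹⁾ ▷ v) ⊗ l^[∞]`. -/
noncomputable def perm {L : Type*} [AddCommGroup L] [Module k L] (δ : L →ₗ[k] H ⊗[k] L)
    (ρ : H →ₐ[k] Module.End k V) : L ⊗[k] V →ₗ[k] V ⊗[k] L :=
  TensorProduct.lift ((LinearMap.rTensorHom L ∘ₗ ρ.toLinearMap.flip).flip ∘ₗ δ)

/-- `(x ⊗ y ⊗ z) ⊗ (g ⊗ v) ↦ x g γ(z) ⊗ (y ▷ v)`, where `γ` is the antipode. -/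
noncomputable def ydTwist (ρ : H →ₐ[k] Module.End k V) :
    H ⊗[k] (H ⊗[k] H) →ₗ[k] (H ⊗[k] V →ₗ[k] H ⊗[k] V) :=
  TensorProduct.homTensorHomMap (RingHom.id k) H V H V ∘ₗ
    TensorProduct.map
      (TensorProduct.lift ((LinearMap.llcomp k H H H).compl₁₂ (LinearMap.mul k H)
        ((LinearMap.mul k H).flip ∘ₗ HopfAlgebra.antipode k)))
      ρ.toLinearMap ∘ₗ
    (TensorProduct.assoc k H H H).symm.toLinearMap ∘ₗ
    LinearMap.lTensor H (TensorProduct.comm k H H).toLinearMap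

lemma ydTwist_tmul (ρ : H →ₐ[k] Module.End k V) (x y z g : H) (v : V) :
    ydTwist ρ (x ⊗ₜ (y ⊗ₜ z)) (g ⊗ₜ v) =
      (x * (g * HopfAlgebra.antipode k z)) ⊗ₜ[k] (ρ y v) := by
  simp [ydTwist]

lemma perm_tmul {L : Type*} [AddCommGroup L] [Module k L] (δ : L →ₗ[k] H ⊗[k] L)
    (ρ : H →ₐ[k] Module.End k V) (l : L) (v : V) :
    perm δ ρ (l ⊗ₜ v) = LinearMap.rTensor L (ρ.toLinearMap.flip v) (δ l) := by
  simp [perm]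

lemma tensorAct_tmul (ρ : H →ₐ[k] Module.End k V) (σ : H →ₐ[k] Module.End k W) (h : H)
    (v : V) (w : W) :
    tensorAct ρ σ h (v ⊗ₜ w) = TensorProduct.map (ρ.toLinearMap.flip v) (σ.toLinearMap.flip w)
      (Coalgebra.comul (R := k) h) := by
  simp only [tensorAct, AlgHom.comp_apply, Bialgebra.comulAlgHom_apply]
  induction Coalgebra.comul (R := k) h using TensorProduct.induction_on with
  | zero => simp
  | tmul x y => simp [Module.endTensorEndAlgHom_apply]
  | add x y hx hy => simp [hx, hy]

end Actions

/-- A base algebra over the Hopf algebra `H`: a unital algebra `L` which is a left `H`-module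
algebra under `act`, a left `H`-comodule algebra under `coact`, satisfies the Yetter-Drinfeld
condition, and is braided commutative. -/
structure BaseAlgebra (k H L : Type*) [Field k] [Ring H] [HopfAlgebra k H]
    [Ring L] [Algebra k L] where
  act : H →ₐ[k] Module.End k L
  act_one : ∀ h, act h 1 = Coalgebra.counit (R := k) h • (1 : L)
  act_mul : ∀ h, act h ∘ₗ LinearMap.mul' k L = LinearMap.mul' k L ∘ₗ tensorAct act act h
  coact : L →ₐ[k] H ⊗[k] L
  coact_coassoc :
    (TensorProduct.assoc k H H L).toLinearMap ∘ₗ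
        (Coalgebra.comul (R := k) (A := H)).rTensor L ∘ₗ coact.toLinearMap =
      coact.toLinearMap.lTensor H ∘ₗ coact.toLinearMap
  coact_counit : ∀ l, (Coalgebra.counit (R := k) (A := H)).rTensor L (coact l) = 1 ⊗ₜ[k] l
  /-- `δ(h ▷ l) = h⁽¹⁾ l⁽¹⁾ γ(h⁽³⁾) ⊗ (h⁽²⁾ ▷ l^[∞])` -/
  yetterDrinfeld : ∀ h l, coact (act h l) =
    ydTwist act ((Coalgebra.comul (R := k) (A := H)).lTensor H (Coalgebra.comul (R := k) h))
      (coact l)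
  /-- `l m = (l⁽¹⁾ ▷ m) l^[∞]` -/
  braided_comm : LinearMap.mul' k L ∘ₗ perm coact.toLinearMap act = LinearMap.mul' k L

/-- For a map `⋇ : A ⊗ A → A ⊗ L`, the map `x ⊗ l ↦ (⋇ x) l`, that is `⋇ ⊗ id` followed by the
multiplication of `L`. -/
noncomputable def mulTail {k A L : Type*} [Field k] [Ring L] [Algebra k L] [AddCommGroup A]
    [Module k A] (mul : A ⊗[k] A →ₗ[k] A ⊗[k] L) : (A ⊗[k] A) ⊗[k] L →ₗ[k] A ⊗[k] L :=
  (LinearMap.mul' k L).lTensor A ∘ₗ (TensorProduct.assoc k A L L).toLinearMap ∘ₗ mul.rTensor L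

/-- A unital dynamical algebra over the base `(H, L)`: an `H`-module `A` with an equivariant
multiplication `⋇ : A ⊗ A → A ⊗ L` satisfying shifted associativity, i.e. the two paths
`A ⊗ A ⊗ A → A ⊗ L ⊗ A → A ⊗ A ⊗ L → A ⊗ L ⊗ L → A ⊗ L` and
`A ⊗ A ⊗ A → A ⊗ A ⊗ L → A ⊗ L ⊗ L → A ⊗ L` agree, and with a unit. -/
structure DynamicalAlgebra {k H L : Type*} [Field k] [Ring H] [HopfAlgebra k H]
    [Ring L] [Algebra k L] (β : BaseAlgebra k H L) (A : Type*) [AddCommGroup A] [Module k A] where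
  act : H →ₐ[k] Module.End k A
  mul : A ⊗[k] A →ₗ[k] A ⊗[k] L
  equivariant : ∀ h, mul ∘ₗ tensorAct act act h = tensorAct act β.act h ∘ₗ mul
  shifted_assoc :
    mulTail mul ∘ₗ (TensorProduct.assoc k A A L).symm.toLinearMap ∘ₗ
        (perm β.coact.toLinearMap act).lTensor A ∘ₗ
        (TensorProduct.assoc k A L A).toLinearMap ∘ₗ mul.rTensor A =
      mulTail mul ∘ₗ (TensorProduct.assoc k A A L).symm.toLinearMap ∘ₗ
        mul.lTensor A ∘ₗ (TensorProduct.assoc k A A A).toLinearMap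
  one : A
  one_mul : ∀ a, mul (one ⊗ₜ a) = a ⊗ₜ (1 : L)
  mul_one : ∀ a, mul (a ⊗ₜ one) = a ⊗ₜ (1 : L)

section Smash

variable {k H L A : Type*} [Field k] [Ring H] [HopfAlgebra k H] [Ring L] [Algebra k L]
  [AddCommGroup A] [Module k A] {β : BaseAlgebra k H L} (D : DynamicalAlgebra β A)

/-- The right action `(a ⊗ l) m = a ⊗ l m` of `L` on `A ⊗ L`. -/
noncomputable def rightL (m : L) : A ⊗[k] L →ₗ[k] A ⊗[k] L :=
  (LinearMap.mulRight k m).lTensor A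

/-- `a ⊗ (b ⊗ m) ↦ (a ⋇ b) m` -/
noncomputable def leftA : A →ₗ[k] Module.End k (A ⊗[k] L) :=
  TensorProduct.curry (mulTail D.mul ∘ₗ (TensorProduct.assoc k A A L).symm.toLinearMap)

/-- `l ⊗ (b ⊗ m) ↦ (l⁽¹⁾ ▷ b) ⊗ l^[∞] m` -/
noncomputable def leftL : L →ₗ[k] Module.End k (A ⊗[k] L) :=
  TensorProduct.curry ((LinearMap.mul' k L).lTensor A ∘ₗ
    (TensorProduct.assoc k A L L).toLinearMap ∘ₗ (perm β.coact.toLinearMap D.act).rTensor L ∘ₗ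
      (TensorProduct.assoc k L A L).symm.toLinearMap)

/-- The multiplication of the dynamical smash product on `A ⊗ L`,
`(a ⊗ l)(b ⊗ m) = (a ⋇ (l⁽¹⁾ ▷ b)) (l^[∞] m)`. -/
noncomputable def smashMul : A ⊗[k] L →ₗ[k] Module.End k (A ⊗[k] L) :=
  TensorProduct.lift ((LinearMap.mul k (Module.End k (A ⊗[k] L))).compl₁₂ (leftA D) (leftL D))

lemma smashMul_tmul (a : A) (l : L) (y : A ⊗[k] L) :
    smashMul D (a ⊗ₜ l) y = leftA D a (leftL D l y) := by
  simp [smashMul]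

lemma smashMul_tmul' (a : A) (l : L) : smashMul D (a ⊗ₜ l) = leftA D a * leftL D l := by
  simp [smashMul]

lemma rightL_tmul (m : L) (a : A) (l : L) : rightL (k := k) m (a ⊗ₜ l) = a ⊗ₜ[k] (l * m) := by
  simp [rightL]

lemma rightL_mul (m n : L) (x : A ⊗[k] L) : rightL (m * n) x = rightL n (rightL m x) := by
  induction x using TensorProduct.induction_on with
  | zero => simp
  | tmul a l => simp [rightL_tmul, mul_assoc]
  | add x y hx hy => simp [hx, hy]

lemma assocMul_eq (x : A ⊗[k] L) (m : L) :
    (LinearMap.mul' k L).lTensor A (TensorProduct.assoc k A L L (x ⊗ₜ m)) = rightL m x := by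
  induction x using TensorProduct.induction_on with
  | zero => simp
  | tmul a l => simp [rightL_tmul]
  | add x y hx hy => simp [add_tmul, hx, hy]

lemma mulTail_tmul (x : A ⊗[k] A) (m : L) : mulTail D.mul (x ⊗ₜ m) = rightL m (D.mul x) := by
  simp [mulTail, assocMul_eq]

lemma leftA_tmul (a b : A) (m : L) : leftA D a (b ⊗ₜ m) = rightL m (D.mul (a ⊗ₜ b)) := by
  simp [leftA, mulTail_tmul]

lemma leftL_tmul (l : L) (b : A) (m : L) :
    leftL D l (b ⊗ₜ m) = rightL m (perm β.coact.toLinearMap D.act (l ⊗ₜ b)) := by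
  simp [leftL, assocMul_eq]

lemma leftA_rightL (a : A) (m : L) (x : A ⊗[k] L) :
    leftA D a (rightL m x) = rightL m (leftA D a x) := by
  induction x using TensorProduct.induction_on with
  | zero => simp
  | tmul b l => simp [rightL_tmul, leftA_tmul, rightL_mul]
  | add x y hx hy => simp [hx, hy]

lemma leftL_rightL (l m : L) (x : A ⊗[k] L) :
    leftL D l (rightL m x) = rightL m (leftL D l x) := by
  induction x using TensorProduct.induction_on with
  | zero => simp
  | tmul b l => simp [rightL_tmul, leftL_tmul, rightL_mul]
  | add x y hx hy => simp [hx, hy]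

lemma smashMul_rightL (x : A ⊗[k] L) (m : L) (y : A ⊗[k] L) :
    smashMul D x (rightL m y) = rightL m (smashMul D x y) := by
  induction x using TensorProduct.induction_on with
  | zero => simp
  | tmul b l => simp [smashMul_tmul, leftA_rightL, leftL_rightL]
  | add x y hx hy => simp [hx, hy]

/-- Two endomorphisms commuting with the right `L`-action agree if they agree on `A ⊗ 1`. -/
lemma ext_rightL {M : Type*} [AddCommGroup M] [Module k M] {f g : A ⊗[k] L →ₗ[k] A ⊗[k] L}
    (hf : ∀ m x, f (rightL m x) = rightL m (f x)) (hg : ∀ m x, g (rightL m x) = rightL m (g x))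
    (h : ∀ a, f (a ⊗ₜ 1) = g (a ⊗ₜ 1)) : f = g := by
  ext a l
  have := congrArg (rightL l) (h a)
  simpa [← hf, ← hg, rightL_tmul] using this


lemma leftL_rTensor (l : L) (b : A) (x : H ⊗[k] L) :
    leftL D l ((D.act.toLinearMap.flip b).rTensor L x) =
      (D.act.toLinearMap.flip b).rTensor L (β.coact l * x) := by
  induction x using TensorProduct.induction_on with
  | zero => simp
  | add x y hx hy => simp [hx, hy, mul_add]
  | tmul g m =>
    simp only [LinearMap.rTensor_tmul, leftL_tmul, perm_tmul, AlgHom.toLinearMap_apply]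
    induction β.coact l using TensorProduct.induction_on with
    | zero => simp
    | add x y hx hy => rw [map_add, map_add, hx, hy, add_mul, map_add]
    | tmul h n => simp [rightL_tmul]

lemma leftL_mul (l m : L) : leftL D (l * m) = leftL D l * leftL D m := by
  refine ext_rightL (M := A) (fun m x => leftL_rightL D _ m x)
    (fun n x => by simp [leftL_rightL]) fun b => ?_
  have h1 : ∀ x : A ⊗[k] L, rightL 1 x = x := fun x => by simp [rightL]
  simp only [Module.End.mul_apply, leftL_tmul, h1, perm_tmul, AlgHom.toLinearMap_apply,
    leftL_rTensor, map_mul]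

lemma rightL_one (x : A ⊗[k] L) : rightL 1 x = x := by simp [rightL]

lemma leftL_one : leftL D 1 = 1 := by
  refine ext_rightL (M := A) (fun m x => leftL_rightL D _ m x) (fun n x => by simp) fun b => ?_
  simp [leftL_tmul, rightL_one, perm_tmul, Algebra.TensorProduct.one_def]

/-- The action of `H` on `A ⊗ L`. -/
noncomputable def smashAct : H →ₐ[k] Module.End k (A ⊗[k] L) := tensorAct D.act β.act

lemma rightL_add (m n : L) (x : A ⊗[k] L) : rightL (m + n) x = rightL m x + rightL n x := by
  induction x using TensorProduct.induction_on with
  | zero => simp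
  | tmul a l => simp [rightL_tmul, mul_add, tmul_add]
  | add x y hx hy => simp only [map_add, hx, hy]; abel

lemma rightL_smul (c : k) (m : L) (x : A ⊗[k] L) : rightL (c • m) x = c • rightL m x := by
  induction x using TensorProduct.induction_on with
  | zero => simp
  | tmul a l => simp [rightL_tmul]
  | add x y hx hy => simp only [map_add, smul_add, hx, hy]

/-- `g ⊗ n ↦ (g ▷ y) n` -/
noncomputable def actRight (y : A ⊗[k] L) : H ⊗[k] L →ₗ[k] A ⊗[k] L :=
  TensorProduct.lift (LinearMap.mk₂ k (fun g n => rightL n (smashAct D g y))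
    (by simp) (by simp) (by simp [rightL_add]) (by simp [rightL_smul]))

lemma actRight_tmul (y : A ⊗[k] L) (g : H) (n : L) :
    actRight D y (g ⊗ₜ n) = rightL n (smashAct D g y) := by simp [actRight]

lemma leftL_eq (l : L) (y : A ⊗[k] L) : leftL D l y = actRight D y (β.coact l) := by
  induction y using TensorProduct.induction_on with
  | zero =>
    have : actRight D 0 = 0 := by ext; simp [actRight_tmul]
    simp [this]
  | add x y hx hy =>
    have : actRight D (x + y) = actRight D x + actRight D y := by ext; simp [actRight_tmul]
    simp [hx, hy, this]
  | tmul b s =>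
    let T : H ⊗[k] (H ⊗[k] L) →ₗ[k] A ⊗[k] L :=
      TensorProduct.map (D.act.toLinearMap.flip b)
        (LinearMap.mul' k L ∘ₗ (β.act.toLinearMap.flip s).rTensor L)
    have e1 : ∀ x : H ⊗[k] L, rightL s ((D.act.toLinearMap.flip b).rTensor L x) =
        T (β.coact.toLinearMap.lTensor H x) := by
      intro x
      induction x using TensorProduct.induction_on with
      | zero => simp
      | add x y hx hy => simp [hx, hy]
      | tmul g n =>
        have := LinearMap.congr_fun β.braided_comm (n ⊗ₜ s)
        simp only [LinearMap.comp_apply, perm_tmul, LinearMap.mul'_apply] at this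
        simp [T, rightL_tmul, ← this]
    have e2 : ∀ x : H ⊗[k] L, actRight D (b ⊗ₜ s) x =
        T (TensorProduct.assoc k H H L ((Coalgebra.comul (R := k) (A := H)).rTensor L x)) := by
      intro x
      induction x using TensorProduct.induction_on with
      | zero => simp
      | add x y hx hy => simp [hx, hy]
      | tmul g n =>
        rw [actRight_tmul, smashAct, tensorAct_tmul, LinearMap.rTensor_tmul]
        induction Coalgebra.comul (R := k) g using TensorProduct.induction_on with
        | zero => simp
        | add x y hx hy => simp [hx, hy, add_tmul]
        | tmul g g' => simp [T, rightL_tmul]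
    rw [leftL_tmul, perm_tmul, e2, e1]
    exact congrArg T (LinearMap.congr_fun β.coact_coassoc l).symm

lemma leftL_leftA (l : L) (b : A) :
    leftL D l * leftA D b = smashMul D (perm β.coact.toLinearMap D.act (l ⊗ₜ b)) := by
  refine ext_rightL (M := A) (fun m x => by simp [leftL_rightL, leftA_rightL])
    (fun n x => smashMul_rightL D _ _ _) fun c => ?_
  let T : H ⊗[k] (H ⊗[k] L) →ₗ[k] A ⊗[k] L :=
    TensorProduct.lift (leftA D) ∘ₗ TensorProduct.map (D.act.toLinearMap.flip b)
      ((D.act.toLinearMap.flip c).rTensor L)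
  have e1 : ∀ x : H ⊗[k] L, smashMul D ((D.act.toLinearMap.flip b).rTensor L x) (c ⊗ₜ 1) =
      T (β.coact.toLinearMap.lTensor H x) := by
    intro x
    induction x using TensorProduct.induction_on with
    | zero => simp
    | add x y hx hy => simp [hx, hy]
    | tmul g n => simp [T, smashMul_tmul, leftL_tmul, rightL_one, perm_tmul]
  have e2 : ∀ x : H ⊗[k] L, actRight D (D.mul (b ⊗ₜ c)) x =
      T (TensorProduct.assoc k H H L ((Coalgebra.comul (R := k) (A := H)).rTensor L x)) := by
    intro x
    induction x using TensorProduct.induction_on with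
    | zero => simp
    | add x y hx hy => simp [hx, hy]
    | tmul g n =>
      have := LinearMap.congr_fun (D.equivariant g) (b ⊗ₜ c)
      simp only [LinearMap.comp_apply] at this
      rw [actRight_tmul, smashAct, ← this, tensorAct_tmul, LinearMap.rTensor_tmul]
      induction Coalgebra.comul (R := k) g using TensorProduct.induction_on with
      | zero => simp
      | add x y hx hy => simp [hx, hy, add_tmul]
      | tmul g g' => simp [T, leftA_tmul]
  rw [Module.End.mul_apply, leftA_tmul, rightL_one, leftL_eq, perm_tmul, e1, e2]
  exact congrArg T (LinearMap.congr_fun β.coact_coassoc l)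

lemma leftA_leftA (a b : A) : leftA D a * leftA D b = smashMul D (D.mul (a ⊗ₜ b)) := by
  refine ext_rightL (M := A) (fun m x => by simp [leftA_rightL])
    (fun n x => smashMul_rightL D _ _ _) fun c => ?_
  have := LinearMap.congr_fun D.shifted_assoc ((a ⊗ₜ b) ⊗ₜ c)
  have e : ∀ x : A ⊗[k] L, smashMul D x (c ⊗ₜ 1) = (mulTail D.mul)
      ((TensorProduct.assoc k A A L).symm ((perm β.coact.toLinearMap D.act).lTensor A
        (TensorProduct.assoc k A L A (x ⊗ₜ c)))) := by
    intro x
    induction x using TensorProduct.induction_on with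
    | zero => simp
    | add x y hx hy => simp [hx, hy, add_tmul]
    | tmul a l => simp [smashMul_tmul, leftL_tmul, rightL_one, leftA]
  rw [e]
  simp only [LinearMap.comp_apply, LinearMap.rTensor_tmul, LinearEquiv.coe_coe] at this
  rw [this]
  simp [leftA_tmul, rightL_one]
  simp [leftA]

lemma smashMul_rightL_left (x : A ⊗[k] L) (m : L) :
    smashMul D (rightL m x) = smashMul D x * leftL D m := by
  induction x using TensorProduct.induction_on with
  | zero => simp
  | add x y hx hy => simp [hx, hy, add_mul]
  | tmul a l => rw [rightL_tmul, smashMul_tmul', smashMul_tmul', leftL_mul, mul_assoc]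

lemma smashMul_assoc (x y : A ⊗[k] L) :
    smashMul D (smashMul D x y) = smashMul D x * smashMul D y := by
  have hA : ∀ a y, smashMul D (leftA D a y) = leftA D a * smashMul D y := by
    intro a y
    induction y using TensorProduct.induction_on with
    | zero => simp
    | add x y hx hy => simp [hx, hy, mul_add]
    | tmul b m =>
      rw [leftA_tmul, smashMul_rightL_left, ← leftA_leftA, smashMul_tmul', mul_assoc]
  have hL : ∀ l y, smashMul D (leftL D l y) = leftL D l * smashMul D y := by
    intro a y
    induction y using TensorProduct.induction_on with
    | zero => simp
    | add x y hx hy => simp [hx, hy, mul_add]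
    | tmul b m =>
      rw [leftL_tmul, smashMul_rightL_left, ← leftL_leftA, smashMul_tmul', mul_assoc]
  induction x using TensorProduct.induction_on with
  | zero => simp
  | add x y hx hy => simp [hx, hy, add_mul]
  | tmul a l =>
    rw [smashMul_tmul, hA, hL, smashMul_tmul', mul_assoc]

lemma act_one_tmul (h : H) :
    D.act h D.one ⊗ₜ[k] (1 : L) = Coalgebra.counit (R := k) h • (D.one ⊗ₜ[k] (1 : L)) := by
  have base : ∀ (h : H) (a : A), D.mul (tensorAct D.act D.act h (D.one ⊗ₜ a)) =
      D.act h a ⊗ₜ[k] (1 : L) := by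
    intro h a
    have := LinearMap.congr_fun (D.equivariant h) (D.one ⊗ₜ a)
    simp only [LinearMap.comp_apply, D.one_mul] at this
    rw [this, tensorAct_tmul]
    have e : β.act.toLinearMap.flip 1 =
        (LinearMap.toSpanSingleton k L 1) ∘ₗ Coalgebra.counit (R := k) (A := H) := by
      ext h; simp [β.act_one]
    rw [e, ← LinearMap.comp_id (D.act.toLinearMap.flip a), TensorProduct.map_comp,
      LinearMap.comp_apply]
    have := Coalgebra.lTensor_counit_comul (R := k) h
    rw [LinearMap.lTensor] at this
    rw [this]
    simp
  let T : H ⊗[k] (H ⊗[k] H) →ₗ[k] A ⊗[k] L :=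
    D.mul ∘ₗ TensorProduct.map (D.act.toLinearMap.flip D.one)
      (D.act.toLinearMap.flip D.one ∘ₗ LinearMap.mul' k H ∘ₗ
        (HopfAlgebra.antipode k).lTensor H)
  have e1 : ∀ x : H ⊗[k] H, T (TensorProduct.assoc k H H H
      ((Coalgebra.comul (R := k) (A := H)).rTensor H x)) =
      D.act (LinearMap.mul' k H ((HopfAlgebra.antipode k).lTensor H x)) D.one ⊗ₜ[k] (1 : L) := by
    intro x
    induction x using TensorProduct.induction_on with
    | zero => simp
    | add x y hx hy => simp [hx, hy, add_tmul]
    | tmul g n =>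
      simp only [LinearMap.lTensor_tmul, LinearMap.mul'_apply, map_mul, Module.End.mul_apply]
      rw [← base, tensorAct_tmul, LinearMap.rTensor_tmul]
      induction Coalgebra.comul (R := k) g using TensorProduct.induction_on with
      | zero => simp
      | add x y hx hy => simp [hx, hy, add_tmul]
      | tmul g g' => simp [T]
  have e2 : ∀ x : H ⊗[k] H, T ((Coalgebra.comul (R := k) (A := H)).lTensor H x) =
      D.act (TensorProduct.rid k H ((Coalgebra.counit (R := k) (A := H)).lTensor H x)) D.one
        ⊗ₜ[k] (1 : L) := by
    intro x
    induction x using TensorProduct.induction_on with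
    | zero => simp
    | add x y hx hy => simp [hx, hy, add_tmul]
    | tmul g n => simp [T, D.mul_one, Algebra.algebraMap_eq_smul_one, smul_tmul']
  have h1 := e1 (Coalgebra.comul (R := k) h)
  have h2 := e2 (Coalgebra.comul (R := k) h)
  rw [Coalgebra.coassoc_apply, h2] at h1
  simp only [Coalgebra.lTensor_counit_comul, HopfAlgebra.mul_antipode_lTensor_comul_apply] at h1
  simpa [Algebra.algebraMap_eq_smul_one, smul_tmul'] using h1

lemma leftL_one_tmul (l : L) : leftL D l (D.one ⊗ₜ 1) = D.one ⊗ₜ l := by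
  rw [leftL_tmul, rightL_one, perm_tmul, AlgHom.toLinearMap_apply]
  have e : ∀ x : H ⊗[k] L, (D.act.toLinearMap.flip D.one).rTensor L x =
      D.one ⊗ₜ (TensorProduct.lid k L ((Coalgebra.counit (R := k) (A := H)).rTensor L x)) := by
    intro x
    induction x using TensorProduct.induction_on with
    | zero => simp
    | add x y hx hy => simp [hx, hy, tmul_add]
    | tmul g n =>
      have := congrArg (rightL n) (act_one_tmul D g)
      simpa [rightL_tmul, smul_tmul'] using this
  rw [e, β.coact_counit]
  simp

/-- The dynamical smash product `B = A ⋊ L`, with underlying vector space `A ⊗ L`. -/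
def Smash {k H L A : Type*} [Field k] [Ring H] [HopfAlgebra k H] [Ring L] [Algebra k L]
    [AddCommGroup A] [Module k A] {β : BaseAlgebra k H L} (_D : DynamicalAlgebra β A) : Type _ :=
  A ⊗[k] L

noncomputable instance : Ring (Smash D) where
  __ := (inferInstanceAs (AddCommGroup (A ⊗[k] L)) : AddCommGroup (Smash D))
  mul x y := smashMul D x y
  one := (D.one ⊗ₜ[k] (1 : L) : A ⊗[k] L)
  left_distrib x y z := map_add (smashMul D x) y z
  right_distrib x y z := LinearMap.congr_fun (map_add (smashMul D) x y) z
  zero_mul x := LinearMap.congr_fun (map_zero (smashMul D)) x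
  mul_zero x := map_zero (smashMul D x)
  mul_assoc x y z := LinearMap.congr_fun (smashMul_assoc D x y) z
  one_mul x := by
    change smashMul D (D.one ⊗ₜ[k] (1 : L) : A ⊗[k] L) x = x
    induction x using TensorProduct.induction_on with
    | zero => simp
    | add x y hx hy => rw [map_add, hx, hy]
    | tmul a l => simp [smashMul_tmul, leftL_one, leftA_tmul, D.one_mul, rightL_tmul]
  mul_one x := by
    change smashMul D x (D.one ⊗ₜ[k] (1 : L) : A ⊗[k] L) = x
    induction x using TensorProduct.induction_on with
    | zero => simp
    | add x y hx hy => rw [map_add, LinearMap.add_apply, hx, hy]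
    | tmul a l => simp [smashMul_tmul, leftL_one_tmul, leftA_tmul, D.mul_one, rightL_tmul]

noncomputable instance : Algebra k (Smash D) :=
  letI : Module k (Smash D) := inferInstanceAs (Module k (A ⊗[k] L))
  Algebra.ofModule (fun c x y => LinearMap.congr_fun (map_smul (smashMul D) c x) y)
    (fun c x y => map_smul (smashMul D x) c y)

end Smash
section SmashAction

variable {k H L A : Type*} [Field k] [Ring H] [HopfAlgebra k H] [Ring L] [Algebra k L]
  [AddCommGroup A] [Module k A] {β : BaseAlgebra k H L} (D : DynamicalAlgebra β A)

lemma actRight_zero : actRight D 0 = 0 := by ext; simp [actRight_tmul]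

lemma actRight_add (x y : A ⊗[k] L) : actRight D (x + y) = actRight D x + actRight D y := by
  ext; simp [actRight_tmul]

lemma actRight_smul (c : k) (x : A ⊗[k] L) : actRight D (c • x) = c • actRight D x := by
  ext; simp [actRight_tmul]

lemma smashAct_rightL (h : H) (m : L) (x : A ⊗[k] L) :
    smashAct D h (rightL m x) =
      actRight D x ((β.act.toLinearMap.flip m).lTensor H (Coalgebra.comul (R := k) h)) := by
  induction x using TensorProduct.induction_on with
  | zero =>
    have : actRight D 0 = 0 := by ext; simp [actRight_tmul]
    simp [this]
  | add x y hx hy =>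
    have : actRight D (x + y) = actRight D x + actRight D y := by ext; simp [actRight_tmul]
    simp [hx, hy, this]
  | tmul a l =>
    let T : H ⊗[k] (H ⊗[k] H) →ₗ[k] A ⊗[k] L :=
      TensorProduct.map (D.act.toLinearMap.flip a)
        (LinearMap.mul' k L ∘ₗ TensorProduct.map (β.act.toLinearMap.flip l)
          (β.act.toLinearMap.flip m))
    have e1 : TensorProduct.map (D.act.toLinearMap.flip a) (β.act.toLinearMap.flip (l * m)) =
        T ∘ₗ (Coalgebra.comul (R := k) (A := H)).lTensor H := by
      ext g g'
      have := LinearMap.congr_fun (β.act_mul g') (l ⊗ₜ m)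
      simp only [LinearMap.comp_apply, LinearMap.mul'_apply, tensorAct_tmul] at this
      simp [T, this]
    have e2 : ∀ x : H ⊗[k] H, actRight D (a ⊗ₜ l) ((β.act.toLinearMap.flip m).lTensor H x) =
        T (TensorProduct.assoc k H H H ((Coalgebra.comul (R := k) (A := H)).rTensor H x)) := by
      intro x
      induction x using TensorProduct.induction_on with
      | zero => simp
      | add x y hx hy => simp [hx, hy]
      | tmul g n =>
        rw [LinearMap.lTensor_tmul, actRight_tmul, smashAct, tensorAct_tmul,
          LinearMap.rTensor_tmul]
        induction Coalgebra.comul (R := k) g using TensorProduct.induction_on with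
        | zero => simp
        | add x y hx hy => simp only [map_add, hx, hy, add_tmul]
        | tmul g g' => simp [T, rightL_tmul]
    rw [e2, rightL_tmul, smashAct, tensorAct_tmul, e1, Coalgebra.coassoc_apply,
      LinearMap.comp_apply]

lemma smashAct_leftA (h : H) (a : A) (y : A ⊗[k] L) :
    smashAct D h (leftA D a y) = TensorProduct.lift (leftA D)
      (TensorProduct.map (D.act.toLinearMap.flip a) ((smashAct D).toLinearMap.flip y)
        (Coalgebra.comul (R := k) h)) := by
  induction y using TensorProduct.induction_on with
  | zero => simp
  | add x y hx hy => simp [hx, hy, TensorProduct.map_add_right]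
  | tmul b m =>
    let T : H ⊗[k] (H ⊗[k] H) →ₗ[k] A ⊗[k] L :=
      TensorProduct.lift (leftA D) ∘ₗ TensorProduct.map (D.act.toLinearMap.flip a)
        (TensorProduct.map (D.act.toLinearMap.flip b) (β.act.toLinearMap.flip m))
    have e1 : ∀ x : H ⊗[k] H, actRight D (D.mul (a ⊗ₜ b))
        ((β.act.toLinearMap.flip m).lTensor H x) =
        T (TensorProduct.assoc k H H H ((Coalgebra.comul (R := k) (A := H)).rTensor H x)) := by
      intro x
      induction x using TensorProduct.induction_on with
      | zero => simp
      | add x y hx hy => simp [hx, hy]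
      | tmul g n =>
        have := LinearMap.congr_fun (D.equivariant g) (a ⊗ₜ b)
        simp only [LinearMap.comp_apply] at this
        rw [LinearMap.lTensor_tmul, actRight_tmul, smashAct, ← this, tensorAct_tmul,
          LinearMap.rTensor_tmul]
        induction Coalgebra.comul (R := k) g using TensorProduct.induction_on with
        | zero => simp
        | add x y hx hy => simp only [map_add, hx, hy, add_tmul]
        | tmul g g' => simp [T, leftA_tmul]
    have e2 : ∀ x : H ⊗[k] H, TensorProduct.lift (leftA D)
        (TensorProduct.map (D.act.toLinearMap.flip a)
          ((smashAct D).toLinearMap.flip (b ⊗ₜ m)) x) =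
        T ((Coalgebra.comul (R := k) (A := H)).lTensor H x) := by
      intro x
      induction x using TensorProduct.induction_on with
      | zero => simp
      | add x y hx hy => simp [hx, hy]
      | tmul g n => simp [T, smashAct, tensorAct_tmul]
    rw [leftA_tmul, smashAct_rightL, e1, e2, Coalgebra.coassoc_apply]

/-- `h⁽¹⁾ ⊗ h⁽²⁾ ⊗ γ(h⁽³⁾) h⁽⁴⁾ = h⁽¹⁾ ⊗ h⁽²⁾ ⊗ 1` -/
lemma comul_antipode_cancel (h : H) :
    LinearMap.mul' k (H ⊗[k] (H ⊗[k] H)) (TensorProduct.map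
      ((((HopfAlgebra.antipode k).lTensor H).lTensor H) ∘ₗ
        (Coalgebra.comul (R := k) (A := H)).lTensor H ∘ₗ Coalgebra.comul)
      (((TensorProduct.mk k H (H ⊗[k] H)) 1) ∘ₗ (TensorProduct.mk k H H) 1)
      (Coalgebra.comul (R := k) h)) =
    TensorProduct.assoc k H H H (Coalgebra.comul (R := k) h ⊗ₜ 1) := by
  let i : H →ₐ[k] H ⊗[k] (H ⊗[k] H) :=
    (Algebra.TensorProduct.includeRight).comp Algebra.TensorProduct.includeRight
  let u : WithConv (H →ₗ[k] H ⊗[k] (H ⊗[k] H)) := WithConv.toConv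
    ((TensorProduct.assoc k H H H).toLinearMap ∘ₗ (TensorProduct.mk k (H ⊗[k] H) H).flip 1 ∘ₗ
      Coalgebra.comul)
  let v : WithConv (H →ₗ[k] H ⊗[k] (H ⊗[k] H)) :=
    WithConv.toConv (i.toLinearMap ∘ₗ HopfAlgebra.antipode k)
  let w : WithConv (H →ₗ[k] H ⊗[k] (H ⊗[k] H)) := WithConv.toConv i.toLinearMap
  have hvw : v * w = 1 := by
    have := LinearMap.algHom_comp_convMul_distrib i
      (WithConv.toConv (HopfAlgebra.antipode k (A := H))) (WithConv.toConv LinearMap.id)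
    rw [LinearMap.antipode_mul_id] at this
    apply WithConv.ext
    refine Eq.trans this.symm ?_
    ext h; simp
  have huv : u * v = WithConv.toConv ((((HopfAlgebra.antipode k).lTensor H).lTensor H) ∘ₗ
        (Coalgebra.comul (R := k) (A := H)).lTensor H ∘ₗ Coalgebra.comul) := by
    have e : ∀ x : H ⊗[k] H, LinearMap.mul' k _ (TensorProduct.map u.ofConv v.ofConv x) =
        (((HopfAlgebra.antipode k).lTensor H).lTensor H)
          (TensorProduct.assoc k H H H ((Coalgebra.comul (R := k) (A := H)).rTensor H x)) := by
      intro x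
      induction x using TensorProduct.induction_on with
      | zero => simp
      | add x y hx hy => simp [hx, hy]
      | tmul g n =>
        simp only [TensorProduct.map_tmul, LinearMap.mul'_apply, LinearMap.rTensor_tmul, u, v,
          LinearMap.comp_apply, LinearMap.flip_apply, TensorProduct.mk_apply,
          LinearEquiv.coe_coe, AlgHom.toLinearMap_apply]
        induction Coalgebra.comul (R := k) g using TensorProduct.induction_on with
        | zero => simp
        | add x y hx hy => simp only [add_tmul, map_add, hx, hy, add_mul]
        | tmul g g' => simp [i]
    ext h
    rw [LinearMap.convMul_apply, e, Coalgebra.coassoc_apply]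
    simp
  have key : (u * v) * w = u :=
    (mul_assoc u v w).trans ((congrArg (u * ·) hvw).trans (mul_one u))
  rw [huv] at key
  have := congrArg (fun f => f.ofConv h) key
  simp only [LinearMap.convMul_apply] at this
  exact this

lemma smashAct_leftL (h : H) (l : L) (y : A ⊗[k] L) :
    smashAct D h (leftL D l y) = TensorProduct.lift (leftL D)
      (TensorProduct.map (β.act.toLinearMap.flip l) ((smashAct D).toLinearMap.flip y)
        (Coalgebra.comul (R := k) h)) := by
  let F (x : H ⊗[k] L) : H ⊗[k] H →ₗ[k] A ⊗[k] L :=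
    TensorProduct.lift (LinearMap.mk₂ k (fun p q => actRight D (smashAct D q y)
        (ydTwist β.act ((Coalgebra.comul (R := k) (A := H)).lTensor H
          (Coalgebra.comul (R := k) p)) x))
        (by simp) (by simp) (by simp [actRight_add]) (by simp [actRight_smul]))
  have e0 : TensorProduct.lift (leftL D) ∘ₗ
      (TensorProduct.map (β.act.toLinearMap.flip l) ((smashAct D).toLinearMap.flip y)) =
      F (β.coact l) := by
    ext p q
    simp [F, leftL_eq, β.yetterDrinfeld]
  have e1 : ∀ x, smashAct D h (actRight D y x) = F x (Coalgebra.comul (R := k) h) := by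
    intro x
    induction x using TensorProduct.induction_on with
    | zero =>
      have : F 0 = 0 := by ext; simp [F]
      simp [this]
    | add x x' hx hy =>
      have : F (x + x') = F x + F x' := by ext; simp [F]
      simp [this, hx, hy]
    | tmul g n =>
      let T : H ⊗[k] (H ⊗[k] H) →ₗ[k] A ⊗[k] L :=
        actRight D y ∘ₗ TensorProduct.map (LinearMap.mul' k H ∘ₗ (LinearMap.mulLeft k g).lTensor H)
          (β.act.toLinearMap.flip n) ∘ₗ (TensorProduct.assoc k H H H).symm.toLinearMap ∘ₗ
            (TensorProduct.comm k H H).toLinearMap.lTensor H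
      have hT : ∀ p q t, T (p ⊗ₜ (q ⊗ₜ t)) =
          rightL (β.act q n) (smashAct D (p * (g * t)) y) := by
        intro p q t; simp [T, actRight_tmul]
      have e2 : F (g ⊗ₜ n) = T ∘ₗ LinearMap.mul' k (H ⊗[k] (H ⊗[k] H)) ∘ₗ (TensorProduct.map
          ((((HopfAlgebra.antipode k).lTensor H).lTensor H) ∘ₗ
            (Coalgebra.comul (R := k) (A := H)).lTensor H ∘ₗ Coalgebra.comul)
          (((TensorProduct.mk k H (H ⊗[k] H)) 1) ∘ₗ (TensorProduct.mk k H H) 1)) := by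
        refine TensorProduct.ext' fun p q => ?_
        have e3 : ∀ w : H ⊗[k] (H ⊗[k] H),
            actRight D (smashAct D q y) (ydTwist β.act w (g ⊗ₜ n)) =
            T (((HopfAlgebra.antipode k).lTensor H).lTensor H w * (1 ⊗ₜ (1 ⊗ₜ q))) := by
          intro w
          induction w using TensorProduct.induction_on with
          | zero => simp
          | add x y hx hy => simp only [map_add, LinearMap.add_apply, hx, hy, add_mul]
          | tmul u w =>
            induction w using TensorProduct.induction_on with
            | zero => simp
            | add x y hx hy =>
              simp only [tmul_add, map_add, LinearMap.add_apply, hx, hy, add_mul]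
            | tmul v w =>
              rw [ydTwist_tmul, actRight_tmul]
              simp only [LinearMap.lTensor_tmul, Algebra.TensorProduct.tmul_mul_tmul, mul_one, hT]
              simp [map_mul]
        simpa [F] using e3 _
      have e4 : ∀ x : H ⊗[k] H, actRight D (smashAct D g y)
          ((β.act.toLinearMap.flip n).lTensor H x) =
          T (TensorProduct.assoc k H H H (x ⊗ₜ 1)) := by
        intro x
        induction x using TensorProduct.induction_on with
        | zero => simp
        | add x y hx hy => simp only [map_add, hx, hy, add_tmul]
        | tmul p q => simp [hT, actRight_tmul]
      rw [actRight_tmul, smashAct_rightL, e4, ← comul_antipode_cancel, e2]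
      rfl
  rw [leftL_eq, e1, ← e0]
  rfl

lemma smashAct_smashMul (h : H) (x y : A ⊗[k] L) :
    smashAct D h (smashMul D x y) = TensorProduct.lift (smashMul D)
      (TensorProduct.map ((smashAct D).toLinearMap.flip x) ((smashAct D).toLinearMap.flip y)
        (Coalgebra.comul (R := k) h)) := by
  induction x using TensorProduct.induction_on with
  | zero => simp
  | add x y hx hy => simp [hx, hy, TensorProduct.map_add_left]
  | tmul a l =>
    let T : H ⊗[k] (H ⊗[k] H) →ₗ[k] A ⊗[k] L :=
      TensorProduct.lift (leftA D) ∘ₗ TensorProduct.map (D.act.toLinearMap.flip a)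
        (TensorProduct.lift (leftL D) ∘ₗ TensorProduct.map (β.act.toLinearMap.flip l)
          ((smashAct D).toLinearMap.flip y))
    have e1 : ∀ x : H ⊗[k] H, TensorProduct.lift (leftA D)
        (TensorProduct.map (D.act.toLinearMap.flip a)
          ((smashAct D).toLinearMap.flip (leftL D l y)) x) =
        T ((Coalgebra.comul (R := k) (A := H)).lTensor H x) := by
      intro x
      induction x using TensorProduct.induction_on with
      | zero => simp
      | add x y hx hy => simp [hx, hy]
      | tmul g n => simp [T, smashAct_leftL]
    have e2 : ∀ x : H ⊗[k] H, TensorProduct.lift (smashMul D)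
        (TensorProduct.map ((smashAct D).toLinearMap.flip (a ⊗ₜ l))
          ((smashAct D).toLinearMap.flip y) x) =
        T (TensorProduct.assoc k H H H ((Coalgebra.comul (R := k) (A := H)).rTensor H x)) := by
      intro x
      induction x using TensorProduct.induction_on with
      | zero => simp
      | add x y hx hy => simp [hx, hy]
      | tmul g n =>
        have : (smashAct D).toLinearMap.flip (a ⊗ₜ l) g = TensorProduct.map
            (D.act.toLinearMap.flip a) (β.act.toLinearMap.flip l)
            (Coalgebra.comul (R := k) g) := by
          simp [smashAct, tensorAct_tmul]
        rw [TensorProduct.map_tmul, this, LinearMap.rTensor_tmul]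
        induction Coalgebra.comul (R := k) g using TensorProduct.induction_on with
        | zero => simp
        | add x y hx hy =>
          simp only [map_add, add_tmul, hx, hy]
        | tmul g g' => simp [T, smashMul_tmul]
    rw [smashMul_tmul, smashAct_leftA, e1, e2, Coalgebra.coassoc_apply]

lemma smashAct_one (h : H) :
    smashAct D h (D.one ⊗ₜ 1) = Coalgebra.counit (R := k) h • (D.one ⊗ₜ[k] (1 : L)) := by
  rw [smashAct, tensorAct_tmul]
  have e : β.act.toLinearMap.flip 1 =
      (LinearMap.toSpanSingleton k L 1) ∘ₗ Coalgebra.counit (R := k) (A := H) := by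
    ext h; simp [β.act_one]
  have := Coalgebra.lTensor_counit_comul (R := k) h
  rw [LinearMap.lTensor] at this
  rw [e, ← LinearMap.comp_id (D.act.toLinearMap.flip D.one), TensorProduct.map_comp,
    LinearMap.comp_apply, this]
  simpa using act_one_tmul D h

end SmashAction

section Coaction

/-- The dual `H^*` of `H`, an algebra under the convolution product
`⟨η ζ, h⟩ = ⟨η, h⁽¹⁾⟩⟨ζ, h⁽²⟩`. -/
def HDual (k H : Type*) [Field k] [Ring H] [HopfAlgebra k H] : Type _ := WithConv (H →ₗ[k] k)

variable {k H : Type*} [Field k] [Ring H] [HopfAlgebra k H]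

noncomputable instance : Ring (HDual k H) := inferInstanceAs (Ring (WithConv (H →ₗ[k] k)))

noncomputable instance : Algebra k (HDual k H) :=
  inferInstanceAs (Algebra k (WithConv (H →ₗ[k] k)))

/-- An element of `H^*` as a linear functional on `H`. -/
noncomputable def HDual.eval : HDual k H ≃ₗ[k] (H →ₗ[k] k) where
  toFun η := WithConv.ofConv η
  invFun f := WithConv.toConv f
  map_add' _ _ := rfl
  map_smul' _ _ := rfl
  left_inv _ := rfl
  right_inv _ := rfl

lemma HDual.ext {η ζ : HDual k H} (h : ∀ x, HDual.eval η x = HDual.eval ζ x) : η = ζ :=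
  HDual.eval.injective (LinearMap.ext h)

lemma HDual.eval_mul (η ζ : HDual k H) (h : H) : HDual.eval (η * ζ) h =
    LinearMap.mul' k k (TensorProduct.map (HDual.eval η) (HDual.eval ζ)
      (Coalgebra.comul (R := k) h)) := rfl

lemma HDual.eval_one (h : H) : HDual.eval (1 : HDual k H) h = Coalgebra.counit (R := k) h := rfl

/-- The linear isomorphism `V ⊗ H^* ≃ Hom(H, V)`, `v ⊗ η ↦ (h ↦ ⟨η, h⟩ v)`. -/
noncomputable def dualLinearEquiv (k H V : Type*) [Field k] [Ring H] [HopfAlgebra k H]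
    [Module.Finite k H] [AddCommGroup V] [Module k V] :
    V ⊗[k] HDual k H ≃ₗ[k] (H →ₗ[k] V) :=
  TensorProduct.congr (LinearEquiv.refl k V) HDual.eval ≪≫ₗ
    TensorProduct.comm k V (Module.Dual k H) ≪≫ₗ dualTensorHomEquiv k H V

lemma dualLinearEquiv_tmul {V : Type*} [Module.Finite k H] [AddCommGroup V] [Module k V]
    (v : V) (η : HDual k H) (h : H) :
    dualLinearEquiv k H V (v ⊗ₜ η) h = HDual.eval η h • v := by
  simp [dualLinearEquiv]

/-- The right `H^*`-coaction `v ↦ v^[0] ⊗ v^⟨1⟩` dual to a left `H`-action: the element of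
`V ⊗ H^*` with `h ▷ v = v^[0] ⟨v^⟨1⟩, h⟩` for all `h`. -/
noncomputable def dualCoact {V : Type*} [Module.Finite k H] [AddCommGroup V] [Module k V]
    (ρ : H →ₐ[k] Module.End k V) : V →ₗ[k] V ⊗[k] HDual k H :=
  (dualLinearEquiv k H V).symm.toLinearMap ∘ₗ ρ.toLinearMap.flip

lemma dualLinearEquiv_dualCoact {V : Type*} [Module.Finite k H] [AddCommGroup V] [Module k V]
    (ρ : H →ₐ[k] Module.End k V) (v : V) (h : H) :
    dualLinearEquiv k H V (dualCoact ρ v) h = ρ h v := by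
  simp [dualCoact]

/-- The isomorphism `B ⊗ H^* ≃ Hom(H, B)` of algebras, with convolution on the right. -/
noncomputable def dualEquiv (k H B : Type*) [Field k] [Ring H] [HopfAlgebra k H]
    [Module.Finite k H] [Ring B] [Algebra k B] :
    B ⊗[k] HDual k H ≃ₐ[k] WithConv (H →ₗ[k] B) :=
  Algebra.TensorProduct.algEquivOfLinearEquivTensorProduct
    (dualLinearEquiv k H B ≪≫ₗ (WithConv.linearEquiv k (H →ₗ[k] B)).symm)
    (by
      intro b b' η η'
      ext h
      refine (dualLinearEquiv_tmul (b * b') (η * η') h).trans ?_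
      rw [LinearMap.convMul_apply, HDual.eval_mul]
      induction Coalgebra.comul (R := k) h using TensorProduct.induction_on with
      | zero => simp
      | add x y hx hy => simp only [map_add, add_smul, hx, hy]
      | tmul p q =>
        simp [dualLinearEquiv_tmul, smul_smul, mul_comm])
    (by
      ext h
      refine (dualLinearEquiv_tmul (1 : B) (1 : HDual k H) h).trans ?_
      rw [HDual.eval_one, LinearMap.convOne_apply, Algebra.algebraMap_eq_smul_one])

lemma dualEquiv_apply {B : Type*} [Module.Finite k H] [Ring B] [Algebra k B]
    (x : B ⊗[k] HDual k H) : (dualEquiv k H B x).ofConv = dualLinearEquiv k H B x := rfl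

end Coaction

section Bimodules

variable (k B : Type*) [Field k] [Ring B] [Algebra k B]

/-- A subspace of a `B`-bimodule `M` stable under the left and the right action of `B`. The right
action is recorded as an action of `Bᵐᵒᵖ`: `x.b = MulOpposite.op b • x`. -/
structure SubBimodule (M : Type*) [AddCommGroup M] [Module k M] [Module B M] [Module Bᵐᵒᵖ M]
    extends Submodule k M where
  left_mem : ∀ (b : B) {x : M}, x ∈ carrier → b • x ∈ carrier
  right_mem : ∀ (b : B) {x : M}, x ∈ carrier → MulOpposite.op b • x ∈ carrier

variable {k B}
variable {M : Type*} [AddCommGroup M] [Module k M] [Module B M] [Module Bᵐᵒᵖ M]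

/-- The quotient of a bimodule by a sub-bimodule. -/
def SubBimodule.Quot (N : SubBimodule k B M) : Type _ := M ⧸ N.toSubmodule

namespace SubBimodule

variable (N : SubBimodule k B M)

instance : AddCommGroup N.Quot := inferInstanceAs (AddCommGroup (M ⧸ N.toSubmodule))

instance : Module k N.Quot := inferInstanceAs (Module k (M ⧸ N.toSubmodule))

/-- The projection of a bimodule onto its quotient. -/
def proj : M →ₗ[k] N.Quot := N.toSubmodule.mkQ

lemma proj_surjective : Function.Surjective N.proj := N.toSubmodule.mkQ_surjective

section

variable [IsScalarTower k B M]

/-- The left action on the quotient, `b • [x] = [b • x]`. -/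
instance : SMul B N.Quot where
  smul b := N.toSubmodule.mapQ N.toSubmodule (Algebra.lsmul k k M b) fun _ hx => N.left_mem b hx

lemma proj_smul (b : B) (x : M) : N.proj (b • x) = b • N.proj x := rfl

noncomputable instance : Module B N.Quot :=
  Function.Surjective.module B N.proj.toAddMonoidHom N.proj_surjective N.proj_smul

end

section

variable [IsScalarTower k Bᵐᵒᵖ M]

/-- The right action on the quotient, `[x].b = [x.b]`. -/
instance : SMul Bᵐᵒᵖ N.Quot where
  smul b := N.toSubmodule.mapQ N.toSubmodule (Algebra.lsmul k k M b)
    fun _ hx => N.right_mem b.unop hx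

lemma proj_op_smul (b : Bᵐᵒᵖ) (x : M) : N.proj (b • x) = b • N.proj x := rfl

noncomputable instance : Module Bᵐᵒᵖ N.Quot :=
  Function.Surjective.module Bᵐᵒᵖ N.proj.toAddMonoidHom N.proj_surjective N.proj_op_smul

end

instance [IsScalarTower k B M] [IsScalarTower k Bᵐᵒᵖ M] [SMulCommClass B Bᵐᵒᵖ M] : SMulCommClass B Bᵐᵒᵖ N.Quot where
  smul_comm b c x := by
    obtain ⟨x, rfl⟩ := N.proj_surjective x
    rw [← proj_op_smul, ← proj_smul, ← proj_smul, ← proj_op_smul, smul_comm]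

end SubBimodule

/-- A linear map between two `B`-bimodules is a bimodule homomorphism. -/
def IsBimoduleHom {X Y : Type*} [AddCommGroup X] [Module k X] [Module B X] [Module Bᵐᵒᵖ X]
    [AddCommGroup Y] [Module k Y] [Module B Y] [Module Bᵐᵒᵖ Y] (f : X →ₗ[k] Y) : Prop :=
  (∀ (b : B) (x : X), f (b • x) = b • f x) ∧
    ∀ (b : B) (x : X), f (MulOpposite.op b • x) = MulOpposite.op b • f x

end Bimodules

section Characters

variable {k H L : Type*} [Field k] [Ring H] [HopfAlgebra k H] [Ring L] [Algebra k L]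
  {β : BaseAlgebra k H L}

/-- An invariant character of `L`: a unital algebra map `χ : L → k` with
`χ(h ▷ l) = ε(h) χ(l)`. -/
structure InvariantCharacter (β : BaseAlgebra k H L) where
  toAlgHom : L →ₐ[k] k
  invariant : ∀ h l, toAlgHom (β.act h l) = Coalgebra.counit (R := k) h * toAlgHom l

variable (χ : InvariantCharacter β)

/-- `ι_χ : L → H`, `l ↦ l⁽¹⁾ χ(l^[∞])`. -/
noncomputable def iota : L →ₐ[k] H :=
  (Algebra.TensorProduct.rid k k H).toAlgHom.comp
    ((Algebra.TensorProduct.map (AlgHom.id k H) χ.toAlgHom).comp β.coact)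

/-- The right co-regular action `η ↼ h = ⟨η^⟨1⟩, h⟩ η^⟨2⟩` of `H` on `H^*`,
that is `⟨η ↼ h, x⟩ = ⟨η, h x⟩`; the value at `h` and `η`. -/
noncomputable def coregRight (k : Type*) {H : Type*} [Field k] [Ring H] [HopfAlgebra k H] :
    H →ₗ[k] HDual k H →ₗ[k] HDual k H :=
  LinearMap.mk₂ k (fun h η => HDual.eval.symm (HDual.eval η ∘ₗ LinearMap.mulLeft k h))
    (by intros; apply HDual.ext; simp [add_mul]) (by intros; apply HDual.ext; simp)
    (by intros; apply HDual.ext; simp) (by intros; apply HDual.ext; simp)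

lemma coregRight_apply (h : H) (η : HDual k H) (x : H) :
    HDual.eval (coregRight k h η) x = HDual.eval η (h * x) := by
  simp [coregRight]

/-- The left action of `L` on `H^*` given by `l ▸ η = η ↼ γ(ι_χ(l))`. -/
noncomputable def lActDual : L →ₗ[k] HDual k H →ₗ[k] HDual k H :=
  coregRight k ∘ₗ HopfAlgebra.antipode k ∘ₗ (iota χ).toLinearMap

/-- `u⁽¹⁾`, `u⁽²⁾` and the antipode: `(1 ⊗ u⁽¹⁾) Δ(γ(u⁽²⁾)) = γ(u) ⊗ 1`. -/
lemma one_tmul_comul_antipode (u : H) :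
    LinearMap.mul' k (H ⊗[k] H) (TensorProduct.map (TensorProduct.mk k H H 1)
      (Coalgebra.comul (R := k) (A := H) ∘ₗ HopfAlgebra.antipode k) (Coalgebra.comul (R := k) u)) =
    HopfAlgebra.antipode k u ⊗ₜ 1 := by
  let a : WithConv (H →ₗ[k] H ⊗[k] H) := WithConv.toConv (TensorProduct.mk k H H 1)
  let b : WithConv (H →ₗ[k] H ⊗[k] H) :=
    WithConv.toConv ((TensorProduct.mk k H H).flip 1 ∘ₗ HopfAlgebra.antipode k)
  let d : WithConv (H →ₗ[k] H ⊗[k] H) := WithConv.toConv (Coalgebra.comul (R := k) (A := H))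
  let F : WithConv (H →ₗ[k] H ⊗[k] H) :=
    WithConv.toConv (Coalgebra.comul (R := k) (A := H) ∘ₗ HopfAlgebra.antipode k)
  have hdF : d * F = 1 := LinearMap.comul_right_inv
  have hbd : b * d = a := by
    have e : ∀ x : H ⊗[k] H, LinearMap.mul' k _ (TensorProduct.map b.ofConv d.ofConv x) =
        (LinearMap.mul' k H ∘ₗ (HopfAlgebra.antipode k).rTensor H).rTensor H
          ((TensorProduct.assoc k H H H).symm
            ((Coalgebra.comul (R := k) (A := H)).lTensor H x)) := by
      intro x
      induction x using TensorProduct.induction_on with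
      | zero => simp
      | add x y hx hy => simp only [map_add, hx, hy]
      | tmul g n =>
        simp only [TensorProduct.map_tmul, LinearMap.mul'_apply, LinearMap.lTensor_tmul, b, d,
          LinearMap.comp_apply, LinearMap.flip_apply, TensorProduct.mk_apply]
        induction Coalgebra.comul (R := k) n using TensorProduct.induction_on with
        | zero => simp
        | add x y hx hy => simp only [tmul_add, map_add, hx, hy, mul_add]
        | tmul g g' => simp
    have e' : ∀ x : H ⊗[k] H, (LinearMap.mul' k H ∘ₗ (HopfAlgebra.antipode k).rTensor H).rTensor H
        ((Coalgebra.comul (R := k) (A := H)).rTensor H x) =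
        1 ⊗ₜ TensorProduct.lid k H ((Coalgebra.counit (R := k) (A := H)).rTensor H x) := by
      intro x
      induction x using TensorProduct.induction_on with
      | zero => simp
      | add x y hx hy => simp only [map_add, hx, hy, tmul_add]
      | tmul g n => simp [Algebra.algebraMap_eq_smul_one, smul_tmul]
    ext h
    rw [LinearMap.convMul_apply, e, Coalgebra.coassoc_symm_apply, e',
      Coalgebra.rTensor_counit_comul]
    simp [a]
  have key : a * F = b := by
    rw [← hbd]
    exact (mul_assoc b d F).trans ((congrArg (b * ·) hdF).trans (mul_one b))
  have := congrArg (fun f => f.ofConv u) key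
  simp only [LinearMap.convMul_apply] at this
  exact this

/-- `(η (ζ ↼ u⁽¹⁾)) ↼ γ(u⁽²⁾) = (η ↼ γ(u)) ζ` -/
lemma coregRight_cancel (u : H) (η ζ : HDual k H) :
    TensorProduct.lift (LinearMap.mk₂ k
      (fun p q => coregRight k (HopfAlgebra.antipode k q) (η * coregRight k p ζ))
      (by simp [mul_add])
      (fun c p q => by
        rw [map_smul, LinearMap.smul_apply]
        exact (congrArg _ (mul_smul_comm c η (coregRight k p ζ))).trans (map_smul _ c _))
      (by simp) (by simp)) (Coalgebra.comul (R := k) u) =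
      coregRight k (HopfAlgebra.antipode k u) η * ζ := by
  apply HDual.ext
  intro x
  have e : ∀ z : H ⊗[k] H, HDual.eval (TensorProduct.lift (LinearMap.mk₂ k
      (fun p q => coregRight k (HopfAlgebra.antipode k q) (η * coregRight k p ζ))
      (by simp [mul_add])
      (fun c p q => by
        rw [map_smul, LinearMap.smul_apply]
        exact (congrArg _ (mul_smul_comm c η (coregRight k p ζ))).trans (map_smul _ c _))
      (by simp) (by simp)) z) x =
      LinearMap.mul' k k (TensorProduct.map (HDual.eval η) (HDual.eval ζ)
        (LinearMap.mul' k (H ⊗[k] H) (TensorProduct.map (TensorProduct.mk k H H 1)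
          (Coalgebra.comul (R := k) (A := H) ∘ₗ HopfAlgebra.antipode k) z) *
          Coalgebra.comul (R := k) x)) := by
    intro z
    induction z using TensorProduct.induction_on with
    | zero => simp
    | add x y hx hy => simp only [map_add, LinearMap.add_apply, hx, hy, add_mul]
    | tmul p q =>
      simp only [TensorProduct.lift.tmul, LinearMap.mk₂_apply, coregRight_apply,
        HDual.eval_mul, Bialgebra.comul_mul, TensorProduct.map_tmul,
        LinearMap.mul'_apply, TensorProduct.mk_apply, LinearMap.comp_apply]
      rw [mul_assoc]
      induction (Coalgebra.comul (R := k) (HopfAlgebra.antipode k q) *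
          Coalgebra.comul (R := k) x) using TensorProduct.induction_on with
      | zero => simp
      | add x y hx hy => simp only [map_add, hx, hy, mul_add]
      | tmul p q => simp [coregRight_apply]
  rw [e, one_tmul_comul_antipode, HDual.eval_mul]
  induction Coalgebra.comul (R := k) x using TensorProduct.induction_on with
  | zero => simp
  | add x y hx hy => simp only [map_add, hx, hy, mul_add]
  | tmul p q => simp [coregRight_apply]

end Characters

section Galois

variable {k H L A : Type*} [Field k] [Ring H] [HopfAlgebra k H] [Ring L] [Algebra k L]
  [AddCommGroup A] [Module k A] {β : BaseAlgebra k H L} (D : DynamicalAlgebra β A)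

/-- The inclusion `A → B`, `a ↦ a ⊗ 1`. -/
noncomputable def ofA : A →ₗ[k] Smash D := (TensorProduct.mk k A L).flip 1

/-- The inclusion `L → B`, `l ↦ 1 ⊗ l`. -/
noncomputable def ofL : L →ₗ[k] Smash D := TensorProduct.mk k A L D.one

/-- The action of `H` on `B = A ⋊ L`. -/
noncomputable def bAct : H →ₐ[k] Module.End k (Smash D) := smashAct D

lemma mul_ofL (b : Smash D) (l : L) : b * ofL D l = (rightL l (b : A ⊗[k] L) : A ⊗[k] L) := by
  have h : ofL D l = (rightL l (D.one ⊗ₜ[k] (1 : L)) : A ⊗[k] L) := by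
    rw [rightL_tmul, _root_.one_mul]; rfl
  rw [h]
  exact (smashMul_rightL D b l (D.one ⊗ₜ[k] (1 : L))).trans
    (congrArg (rightL l) (mul_one (b : Smash D)))

lemma leftA_one : leftA D D.one = 1 := by
  refine TensorProduct.ext' fun a l => ?_
  simp [leftA_tmul, D.one_mul, rightL_tmul]

lemma ofL_mul (b : Smash D) (l : L) : ofL D l * b = (leftL D l (b : A ⊗[k] L) : A ⊗[k] L) := by
  refine (smashMul_tmul D D.one l b).trans ?_
  rw [leftA_one]
  rfl

variable [Module.Finite k H]

/-- The right coaction `b ↦ b^[0] ⊗ b^⟨1⟩` of `H^*` on `B` dual to the action of `H`, an algebra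
homomorphism. -/
noncomputable def bCoact : Smash D →ₐ[k] Smash D ⊗[k] HDual k H :=
  AlgHom.ofLinearMap (dualCoact (bAct D))
    (by
      apply (dualEquiv k H (Smash D)).injective
      ext h
      rw [dualEquiv_apply, dualLinearEquiv_dualCoact, map_one (dualEquiv k H (Smash D)),
        LinearMap.convOne_apply]
      exact (smashAct_one D h).trans (Algebra.algebraMap_eq_smul_one (A := Smash D) _).symm)
    (by
      intro x y
      apply (dualEquiv k H (Smash D)).injective
      ext h
      rw [dualEquiv_apply, dualLinearEquiv_dualCoact, map_mul (dualEquiv k H (Smash D)),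
        LinearMap.convMul_apply,
        dualEquiv_apply, dualEquiv_apply]
      have e : ∀ b, dualLinearEquiv k H (Smash D) (dualCoact (bAct D) b) =
          (bAct D).toLinearMap.flip b := by
        intro b; ext h; rw [dualLinearEquiv_dualCoact]; rfl
      rw [e, e]
      exact smashAct_smashMul D h x y)

lemma dualLinearEquiv_bCoact (b : Smash D) (h : H) :
    dualLinearEquiv k H (Smash D) (bCoact D b) h = bAct D h b :=
  dualLinearEquiv_dualCoact _ _ _

/-- The vector space `B ⊗ H^*`, to be equipped with its structure of a `B`-bimodule. -/
def SmashDual {k H L A : Type*} [Field k] [Ring H] [HopfAlgebra k H] [Ring L] [Algebra k L]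
    [AddCommGroup A] [Module k A] {β : BaseAlgebra k H L} (D : DynamicalAlgebra β A) : Type _ :=
  Smash D ⊗[k] HDual k H

noncomputable instance : AddCommGroup (SmashDual D) :=
  inferInstanceAs (AddCommGroup (Smash D ⊗[k] HDual k H))

noncomputable instance : Module k (SmashDual D) :=
  inferInstanceAs (Module k (Smash D ⊗[k] HDual k H))

/-- The identity map from `B ⊗ H^*` to itself. -/
noncomputable def SmashDual.of : Smash D ⊗[k] HDual k H ≃ₗ[k] SmashDual D := LinearEquiv.refl k _

/-- The left action `a.(b ⊗ η) = a b ⊗ η`, i.e. left multiplication by `a ⊗ 1`. -/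
noncomputable instance : Module (Smash D) (SmashDual D) where
  smul a x := SmashDual.of D ((a ⊗ₜ 1) * (SmashDual.of D).symm x)
  one_smul x := one_mul ((SmashDual.of D).symm x)
  mul_smul a b x := by
    change (_ : Smash D ⊗[k] HDual k H) = (a ⊗ₜ 1) * ((b ⊗ₜ 1) * (SmashDual.of D).symm x)
    rw [← mul_assoc, Algebra.TensorProduct.tmul_mul_tmul, mul_one]
    rfl
  smul_zero a := mul_zero (a ⊗ₜ[k] (1 : HDual k H))
  smul_add a x y := mul_add (a ⊗ₜ[k] (1 : HDual k H)) ((SmashDual.of D).symm x) _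
  add_smul a b x := by
    change (_ : Smash D ⊗[k] HDual k H) =
      (a ⊗ₜ 1) * (SmashDual.of D).symm x + (b ⊗ₜ 1) * (SmashDual.of D).symm x
    rw [← add_mul, ← add_tmul]
    rfl
  zero_smul x := by
    change ((0 : Smash D) ⊗ₜ[k] (1 : HDual k H)) * (SmashDual.of D).symm x = 0
    rw [zero_tmul, zero_mul]

/-- The right action `(b ⊗ η).c = b c^[0] ⊗ η c^⟨1⟩`, i.e. right multiplication by the coaction
of `c` in the algebra `B ⊗ H^*`. -/
noncomputable instance : Module (Smash D)ᵐᵒᵖ (SmashDual D) where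
  smul c x := SmashDual.of D ((SmashDual.of D).symm x * bCoact D c.unop)
  one_smul x := by
    change (SmashDual.of D).symm x * bCoact D 1 = (SmashDual.of D).symm x
    rw [map_one, mul_one]
  mul_smul a b x := by
    change (SmashDual.of D).symm x * bCoact D (b.unop * a.unop) =
      ((SmashDual.of D).symm x * bCoact D b.unop) * bCoact D a.unop
    rw [map_mul, mul_assoc]
  smul_zero a := zero_mul (bCoact D a.unop)
  smul_add a x y := add_mul ((SmashDual.of D).symm x) _ (bCoact D a.unop)
  add_smul a b x := by
    change (SmashDual.of D).symm x * bCoact D (a.unop + b.unop) =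
      (SmashDual.of D).symm x * bCoact D a.unop + (SmashDual.of D).symm x * bCoact D b.unop
    rw [map_add, mul_add]
  zero_smul x := by
    change (SmashDual.of D).symm x * bCoact D 0 = 0
    rw [map_zero, mul_zero]

lemma smul_of (a : Smash D) (x : Smash D ⊗[k] HDual k H) :
    a • SmashDual.of D x = SmashDual.of D ((a ⊗ₜ 1) * x) := rfl

lemma op_smul_of (c : Smash D) (x : Smash D ⊗[k] HDual k H) :
    MulOpposite.op c • SmashDual.of D x = SmashDual.of D (x * bCoact D c) := rfl

instance : IsScalarTower k (Smash D) (SmashDual D) where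
  smul_assoc c a x := by
    obtain ⟨x, rfl⟩ := (SmashDual.of D).surjective x
    rw [smul_of, smul_of, ← smul_tmul', smul_mul_assoc, map_smul]

instance : IsScalarTower k (Smash D)ᵐᵒᵖ (SmashDual D) where
  smul_assoc c a x := by
    obtain ⟨x, rfl⟩ := (SmashDual.of D).surjective x
    induction a using MulOpposite.rec' with | _ a =>
    rw [← MulOpposite.op_smul, op_smul_of, op_smul_of, map_smul, mul_smul_comm, map_smul]

instance : SMulCommClass (Smash D) (Smash D)ᵐᵒᵖ (SmashDual D) where
  smul_comm a c x := by
    obtain ⟨x, rfl⟩ := (SmashDual.of D).surjective x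
    induction c using MulOpposite.rec' with | _ c =>
    rw [smul_of, op_smul_of, op_smul_of, smul_of, mul_assoc]

end Galois

section Galois

variable {k H L A : Type*} [Field k] [Ring H] [HopfAlgebra k H] [Ring L] [Algebra k L]
  [AddCommGroup A] [Module k A] {β : BaseAlgebra k H L} (D : DynamicalAlgebra β A)

section TwistedTarget

variable [Module.Finite k H] (χ : InvariantCharacter β)

lemma dualLinearEquiv_tmul_one_mul {B : Type*} [Ring B] [Algebra k B] (b : B)
    (z : B ⊗[k] HDual k H) (h : H) :
    dualLinearEquiv k H B ((b ⊗ₜ 1) * z) h = b * dualLinearEquiv k H B z h := by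
  induction z using TensorProduct.induction_on with
  | zero => simp
  | add x y hx hy => simp only [mul_add, map_add, LinearMap.add_apply, hx, hy]
  | tmul c η => simp [dualLinearEquiv_tmul]

/-- `(g ⊗ n)` acts by `c ⊗ ζ ↦ c n ⊗ (ζ ↼ g)`. -/
noncomputable def twist : H ⊗[k] L →ₗ[k]
    (Smash D ⊗[k] HDual k H →ₗ[k] Smash D ⊗[k] HDual k H) :=
  TensorProduct.lift (LinearMap.mk₂ k
    (fun g n => TensorProduct.map (LinearMap.mulRight k (ofL D n)) (coregRight k g))
    (by intros; rw [map_add, TensorProduct.map_add_right])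
    (by intros; rw [map_smul, TensorProduct.map_smul_right])
    (by intro g m n; rw [← TensorProduct.map_add_left]; congr 1; ext; simp [mul_add])
    (by intro c g n; rw [← TensorProduct.map_smul_left]; congr 1; ext; simp))

lemma twist_tmul (g : H) (n : L) (c : Smash D) (ζ : HDual k H) :
    twist D (g ⊗ₜ n) (c ⊗ₜ ζ) = (c * ofL D n) ⊗ₜ coregRight k g ζ := by
  simp [twist]

lemma ofL_mul_actRight (l : L) (b : Smash D) :
    ofL D l * b = (actRight D b (β.coact l) : A ⊗[k] L) :=
  (ofL_mul D b l).trans (leftL_eq D l b)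

lemma actRight_tmul' (b : Smash D) (g : H) (n : L) :
    (actRight D b (g ⊗ₜ n) : A ⊗[k] L) = bAct D g b * ofL D n :=
  (actRight_tmul D b g n).trans (mul_ofL D _ n).symm

lemma ofL_tmul_mul_bCoact (l : L) (c : Smash D) :
    (ofL D l ⊗ₜ 1) * bCoact D c = twist D (β.coact l) (bCoact D c) := by
  apply (dualLinearEquiv k H (Smash D)).injective
  ext h
  rw [dualLinearEquiv_tmul_one_mul, dualLinearEquiv_bCoact, ofL_mul_actRight]
  induction β.coact l using TensorProduct.induction_on with
  | zero => simp; rfl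
  | add x y hx hy =>
    rw [map_add, map_add, LinearMap.add_apply, map_add, LinearMap.add_apply, ← hx, ← hy]
    rfl
  | tmul g n =>
    have e : ∀ z : Smash D ⊗[k] HDual k H, dualLinearEquiv k H (Smash D) (twist D (g ⊗ₜ n) z) h =
        dualLinearEquiv k H (Smash D) z (g * h) * ofL D n := by
      intro z
      induction z using TensorProduct.induction_on with
      | zero => simp
      | add x y hx hy => simp only [map_add, LinearMap.add_apply, hx, hy, add_mul]
      | tmul c ζ => simp [twist_tmul, dualLinearEquiv_tmul, coregRight_apply]
    rw [e, dualLinearEquiv_bCoact, actRight_tmul', map_mul]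
    rfl

/-- `l^[∞] ▸ (η (ζ ↼ l⁽¹⁾)) = (l ▸ η) ζ` -/
lemma lActDual_cancel (l : L) (η ζ : HDual k H) :
    TensorProduct.lift (LinearMap.mk₂ k
      (fun (g : H) (n : L) => lActDual χ n (η * coregRight k g ζ))
      (by simp [mul_add])
      (fun c p q => by
        rw [map_smul, LinearMap.smul_apply]
        exact (congrArg _ (mul_smul_comm c η (coregRight k p ζ))).trans (map_smul _ c _))
      (by simp) (by simp)) (β.coact l) = lActDual χ l η * ζ := by
  let T : H ⊗[k] H →ₗ[k] HDual k H := TensorProduct.lift (LinearMap.mk₂ k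
      (fun p q => coregRight k (HopfAlgebra.antipode k q) (η * coregRight k p ζ))
      (by simp [mul_add])
      (fun c p q => by
        rw [map_smul, LinearMap.smul_apply]
        exact (congrArg _ (mul_smul_comm c η (coregRight k p ζ))).trans (map_smul _ c _))
      (by simp) (by simp))
  have e1 : ∀ z : H ⊗[k] L, TensorProduct.lift (LinearMap.mk₂ k
      (fun (g : H) (n : L) => lActDual χ n (η * coregRight k g ζ))
      (by simp [mul_add])
      (fun c p q => by
        rw [map_smul, LinearMap.smul_apply]
        exact (congrArg _ (mul_smul_comm c η (coregRight k p ζ))).trans (map_smul _ c _))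
      (by simp) (by simp)) z = T ((iota χ).toLinearMap.lTensor H z) := by
    intro z
    induction z using TensorProduct.induction_on with
    | zero => simp
    | add x y hx hy => simp only [map_add, hx, hy]
    | tmul g n => simp [T, lActDual]
  rw [e1]
  have e2 : (iota χ).toLinearMap.lTensor H (β.coact l) = Coalgebra.comul (iota χ l) := by
    have h := congrArg ((TensorProduct.rid k H).toLinearMap.lTensor H ∘ₗ
      (χ.toAlgHom.toLinearMap.lTensor H).lTensor H) (LinearMap.congr_fun β.coact_coassoc l)
    have h1 : ∀ z : H ⊗[k] L, (TensorProduct.rid k H).toLinearMap.lTensor H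
        ((χ.toAlgHom.toLinearMap.lTensor H).lTensor H (TensorProduct.assoc k H H L
          ((Coalgebra.comul (R := k) (A := H)).rTensor L z))) =
        Coalgebra.comul (TensorProduct.rid k H (χ.toAlgHom.toLinearMap.lTensor H z)) := by
      intro z
      induction z using TensorProduct.induction_on with
      | zero => simp
      | add x y hx hy => simp only [map_add, hx, hy]
      | tmul g n =>
        simp only [LinearMap.rTensor_tmul, LinearMap.lTensor_tmul, TensorProduct.rid_tmul, map_smul]
        induction Coalgebra.comul (R := k) g using TensorProduct.induction_on with
        | zero => simp
        | add x y hx hy => simp only [map_add, add_tmul, smul_add, hx, hy]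
        | tmul p q => simp
    have h2 : ∀ z : H ⊗[k] L, (TensorProduct.rid k H).toLinearMap.lTensor H
        ((χ.toAlgHom.toLinearMap.lTensor H).lTensor H (β.coact.toLinearMap.lTensor H z)) =
        (iota χ).toLinearMap.lTensor H z := by
      intro z
      induction z using TensorProduct.induction_on with
      | zero => simp
      | add x y hx hy => simp only [map_add, hx, hy]
      | tmul g n =>
        simp only [LinearMap.lTensor_tmul]
        rfl
    exact (h2 _).symm.trans (h.symm.trans (h1 _))
  rw [e2]
  exact coregRight_cancel (iota χ l) η ζ

lemma subJ_right_aux (a b : Smash D) (l : L) (η : HDual k H) :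
    SmashDual.of D (((b * ofL D l) ⊗ₜ η) * bCoact D a - (b ⊗ₜ lActDual χ l η) * bCoact D a) ∈
      Submodule.span k {z | ∃ (b : Smash D) (l : L) (η : HDual k H),
        z = SmashDual.of D ((b * ofL D l) ⊗ₜ η - b ⊗ₜ lActDual χ l η)} := by
  have e1 : ((b * ofL D l) ⊗ₜ[k] η) = (b ⊗ₜ η) * (ofL D l ⊗ₜ 1) := by
    rw [Algebra.TensorProduct.tmul_mul_tmul, _root_.mul_one]
  rw [e1, mul_assoc, ofL_tmul_mul_bCoact]
  induction bCoact D a using TensorProduct.induction_on with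
  | zero => simp
  | add x y hx hy =>
    rw [map_add, mul_add, mul_add, add_sub_add_comm, map_add]
    exact Submodule.add_mem _ hx hy
  | tmul c ζ =>
    rw [Algebra.TensorProduct.tmul_mul_tmul, ← lActDual_cancel]
    induction β.coact l using TensorProduct.induction_on with
    | zero => simp
    | add x y hx hy =>
      rw [map_add, LinearMap.add_apply, map_add, mul_add, tmul_add, add_sub_add_comm, map_add]
      exact Submodule.add_mem _ hx hy
    | tmul g n =>
      rw [twist_tmul, Algebra.TensorProduct.tmul_mul_tmul, ← mul_assoc]
      exact Submodule.subset_span ⟨b * c, n, η * coregRight k g ζ, rfl⟩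

/-- The subspace `J_χ` of `B ⊗ H^*` spanned by the elements `b l ⊗ η - b ⊗ (l ▸ η)`, a
sub-bimodule. -/
noncomputable def subJ : SubBimodule k (Smash D) (SmashDual D) where
  toSubmodule := Submodule.span k {z | ∃ (b : Smash D) (l : L) (η : HDual k H),
    z = SmashDual.of D ((b * ofL D l) ⊗ₜ η - b ⊗ₜ lActDual χ l η)}
  left_mem a x hx := by
    refine Submodule.span_induction (p := fun x _ => a • x ∈ Submodule.span k _)
      ?_ ?_ ?_ ?_ hx
    · rintro _ ⟨b, l, η, rfl⟩
      refine Submodule.subset_span ⟨a * b, l, η, ?_⟩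
      rw [smul_of, mul_sub, Algebra.TensorProduct.tmul_mul_tmul,
        Algebra.TensorProduct.tmul_mul_tmul, _root_.one_mul, _root_.one_mul, mul_assoc]
    · rw [smul_zero]; exact Submodule.zero_mem _
    · intro x y _ _ hx hy; rw [smul_add]; exact Submodule.add_mem _ hx hy
    · intro c x _ hx; rw [smul_comm]; exact Submodule.smul_mem _ c hx
  right_mem a x hx := by
    refine Submodule.span_induction (p := fun x _ => MulOpposite.op a • x ∈ Submodule.span k _)
      ?_ ?_ ?_ ?_ hx
    · rintro _ ⟨b, l, η, rfl⟩
      rw [op_smul_of, sub_mul]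
      exact subJ_right_aux D χ a b l η
    · rw [smul_zero]; exact Submodule.zero_mem _
    · intro x y _ _ hx hy; rw [smul_add]; exact Submodule.add_mem _ hx hy
    · intro c x _ hx; rw [smul_comm]; exact Submodule.smul_mem _ c hx

/-- The `B`-bimodule `A ⊗_χ H^*`, the quotient of `B ⊗ H^*` by `J_χ`. -/
abbrev TwistedDual : Type _ := (subJ D χ).Quot

/-- `Γ̌ : B ⊗ B → B ⊗ H^*`, `a ⊗ b ↦ a b^[0] ⊗ b^⟨1⟩`. -/
noncomputable def checkGamma : Smash D ⊗[k] Smash D →ₗ[k] SmashDual D :=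
  (SmashDual.of D).toLinearMap ∘ₗ LinearMap.mul' k (Smash D ⊗[k] HDual k H) ∘ₗ
    TensorProduct.map
      (Algebra.TensorProduct.includeLeft : Smash D →ₐ[k] Smash D ⊗[k] HDual k H).toLinearMap
      (bCoact D).toLinearMap

/-- The map `A ⊗ H^* → A ⊗_χ H^*`, `a ⊗ η ↦ [a ⊗ η]`, where `A` is regarded as a subspace of
`B`. -/
noncomputable def toTwistedDual : A ⊗[k] HDual k H →ₗ[k] TwistedDual D χ :=
  (subJ D χ).proj ∘ₗ (SmashDual.of D).toLinearMap ∘ₗ (ofA D).rTensor (HDual k H)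

end TwistedTarget

section Theta

variable [Module.Finite k H]

/-- The action on `L` of an element `f` of `H^*` (regarded as a subspace of the double of `H`),
`f ▷ l = ⟨f, l⁽¹⁾⟩ l^[∞]`. -/
noncomputable def dualAct (β : BaseAlgebra k H L) (f : Module.Dual k H) : L →ₗ[k] L :=
  (TensorProduct.lid k L).toLinearMap ∘ₗ f.rTensor L ∘ₗ β.coact.toLinearMap

/-- The action on `L` of the element `Θ₁ γ(Θ₂) = ∑ᵢ ηⁱ γ(hᵢ)` of the double of `H`, where `hᵢ` is
a basis of `H` and `ηⁱ` the dual basis; this does not depend on the basis. -/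
noncomputable def thetaBar (β : BaseAlgebra k H L) : L →ₗ[k] L :=
  ∑ i, dualAct β ((Module.finBasis k H).coord i) ∘ₗ
    β.act (HopfAlgebra.antipode k (Module.finBasis k H i))

/-- The adjoint character `χ̃(l) = χ(Θ₁ γ(Θ₂) ▷ l)`. -/
noncomputable def chiTilde (χ : InvariantCharacter β) : L →ₗ[k] k :=
  χ.toAlgHom.toLinearMap ∘ₗ thetaBar β

end Theta

section Induced

/-- The relations `b l = χ(l) b` defining `B ⊗_L k_χ` as a quotient of `B`. -/
noncomputable def leftRel (χ : L →ₗ[k] k) : Submodule (Smash D) (Smash D) :=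
  Submodule.span (Smash D) {z | ∃ (b : Smash D) (l : L), z = b * ofL D l - χ l • b}

/-- The relations `l b = χ(l) b` defining `k_χ ⊗_L B` as a quotient of `B`. -/
noncomputable def rightRel (χ : L →ₗ[k] k) : Submodule (Smash D)ᵐᵒᵖ (Smash D) :=
  Submodule.span (Smash D)ᵐᵒᵖ {z | ∃ (b : Smash D) (l : L), z = ofL D l * b - χ l • b}

/-- The left `B`-module `A_χ = B ⊗_L k_χ` induced from the character `χ` of `L`. -/
def LeftInd (χ : L →ₗ[k] k) : Type _ := Smash D ⧸ leftRel D χ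

/-- The right `B`-module `_χA = k_χ ⊗_L B` induced from the character `χ` of `L`. -/
def RightInd (χ : L →ₗ[k] k) : Type _ := Smash D ⧸ rightRel D χ

variable (χ : L →ₗ[k] k)

noncomputable instance : AddCommGroup (LeftInd D χ) :=
  inferInstanceAs (AddCommGroup (Smash D ⧸ leftRel D χ))
noncomputable instance : Module k (LeftInd D χ) :=
  inferInstanceAs (Module k (Smash D ⧸ leftRel D χ))
noncomputable instance : Module (Smash D) (LeftInd D χ) :=
  inferInstanceAs (Module (Smash D) (Smash D ⧸ leftRel D χ))
instance : IsScalarTower k (Smash D) (LeftInd D χ) :=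
  inferInstanceAs (IsScalarTower k (Smash D) (Smash D ⧸ leftRel D χ))
noncomputable instance : AddCommGroup (RightInd D χ) :=
  inferInstanceAs (AddCommGroup (Smash D ⧸ rightRel D χ))
noncomputable instance : Module k (RightInd D χ) :=
  inferInstanceAs (Module k (Smash D ⧸ rightRel D χ))
noncomputable instance : Module (Smash D)ᵐᵒᵖ (RightInd D χ) :=
  inferInstanceAs (Module (Smash D)ᵐᵒᵖ (Smash D ⧸ rightRel D χ))
instance : IsScalarTower k (Smash D)ᵐᵒᵖ (RightInd D χ) :=
  inferInstanceAs (IsScalarTower k (Smash D)ᵐᵒᵖ (Smash D ⧸ rightRel D χ))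

/-- The projection `℘_χ : B → A_χ`. -/
noncomputable def wpLeft : Smash D →ₗ[k] LeftInd D χ :=
  ((leftRel D χ).mkQ).restrictScalars k

/-- The projection `_χ℘ : B → _χA`. -/
noncomputable def wpRight : Smash D →ₗ[k] RightInd D χ :=
  ((rightRel D χ).mkQ).restrictScalars k

lemma wpLeft_surjective : Function.Surjective (wpLeft D χ) := (leftRel D χ).mkQ_surjective

lemma wpRight_surjective : Function.Surjective (wpRight D χ) := (rightRel D χ).mkQ_surjective

lemma wpLeft_mul (a b : Smash D) : wpLeft D χ (a * b) = a • wpLeft D χ b := rfl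

lemma wpRight_mul (a b : Smash D) :
    wpRight D χ (a * b) = MulOpposite.op b • wpRight D χ a := rfl

lemma wpLeft_mul_ofL (b : Smash D) (l : L) : wpLeft D χ (b * ofL D l) = χ l • wpLeft D χ b := by
  rw [← sub_eq_zero, ← map_smul, ← map_sub]
  exact (Submodule.Quotient.mk_eq_zero _).2 (Submodule.subset_span ⟨b, l, rfl⟩)

lemma wpRight_ofL_mul (b : Smash D) (l : L) :
    wpRight D χ (ofL D l * b) = χ l • wpRight D χ b := by
  rw [← sub_eq_zero, ← map_smul, ← map_sub]
  exact (Submodule.Quotient.mk_eq_zero _).2 (Submodule.subset_span ⟨b, l, rfl⟩)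

/-- The space `A^H` of invariants, which underlies the algebra `I_χ`. -/
def invariants : Submodule k A where
  carrier := {a | ∀ h, D.act h a = Coalgebra.counit (R := k) h • a}
  add_mem' ha hb h := by simp [ha h, hb h]
  zero_mem' h := by simp
  smul_mem' c a ha h := by simp [ha h, smul_comm c]

lemma ofL_mul_ofA {c : A} (hc : c ∈ invariants D) (l : L) :
    ofL D l * ofA D c = ofA D c * ofL D l := by
  rw [ofL_mul, mul_ofL]
  have e : D.act.toLinearMap.flip c =
      LinearMap.toSpanSingleton k A c ∘ₗ Coalgebra.counit (R := k) (A := H) := by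
    ext h; simpa using hc h
  have h1 : leftL D l (c ⊗ₜ 1) = c ⊗ₜ l := by
    rw [leftL_tmul, rightL_one, perm_tmul, e, LinearMap.rTensor_comp, LinearMap.comp_apply,
      AlgHom.toLinearMap_apply, β.coact_counit]
    simp
  have h2 : rightL l (c ⊗ₜ[k] (1 : L)) = c ⊗ₜ l := by rw [rightL_tmul, _root_.one_mul]
  exact h1.trans h2.symm

/-- The right action of `I_χ` on `A_χ = B ⊗_L k_χ`: right multiplication by `c ∈ A^H`. -/
noncomputable def starRight (c : invariants D) : LeftInd D χ →ₗ[Smash D] LeftInd D χ :=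
  (leftRel D χ).mapQ (leftRel D χ) (LinearMap.toSpanSingleton (Smash D) (Smash D) (ofA D c))
    (by
      refine Submodule.span_le.2 ?_
      rintro _ ⟨b, l, rfl⟩
      refine Submodule.subset_span ⟨b * ofA D c, l, ?_⟩
      rw [LinearMap.toSpanSingleton_apply, smul_eq_mul, sub_mul, mul_assoc, mul_assoc,
        ofL_mul_ofA D c.2, smul_mul_assoc])

/-- The left action of `I_χ` on `_χA = k_χ ⊗_L B`: left multiplication by `c ∈ A^H`. -/
noncomputable def starLeft (c : invariants D) : RightInd D χ →ₗ[(Smash D)ᵐᵒᵖ] RightInd D χ :=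
  (rightRel D χ).mapQ (rightRel D χ)
    { toFun := fun b => ofA D c * b
      map_add' := mul_add _
      map_smul' := fun b x => (mul_assoc (ofA D (c : A)) x b.unop).symm }
    (by
      refine Submodule.span_le.2 ?_
      rintro _ ⟨b, l, rfl⟩
      refine Submodule.subset_span ⟨ofA D c * b, l, ?_⟩
      change ofA D c * (ofL D l * b - χ l • b) = _
      rw [mul_sub, ← mul_assoc, ← mul_assoc, ofL_mul_ofA D c.2, mul_smul_comm])

end Induced
end Galois

section Balanced

variable {k H L A : Type*} [Field k] [Ring H] [HopfAlgebra k H] [Ring L] [Algebra k L]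
  [AddCommGroup A] [Module k A] {β : BaseAlgebra k H L} (D : DynamicalAlgebra β A)

lemma wpLeft_tensor (χ : L →ₗ[k] k) (x : A ⊗[k] L) :
    wpLeft D χ x = wpLeft D χ (ofA D (TensorProduct.rid k A (χ.lTensor A x))) := by
  induction x using TensorProduct.induction_on with
  | zero =>
    rw [map_zero, map_zero, map_zero]
    rfl
  | add x y hx hy =>
    rw [map_add, map_add, map_add, map_add, ← hx, ← hy]
    rfl
  | tmul a l =>
    have h : (a ⊗ₜ[k] l : A ⊗[k] L) = ofA D a * ofL D l := by
      refine Eq.trans ?_ (mul_ofL D (ofA D a) l).symm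
      exact ((rightL_tmul l a (1 : L)).trans (by rw [_root_.one_mul])).symm
    have h' := wpLeft_mul_ofL D χ (ofA D a) l
    rw [← map_smul, ← map_smul] at h'
    refine (congrArg (wpLeft D χ) h).trans (h'.trans ?_)
    simp

/-- The operation `a ⋆_χ b = (id ⊗ χ)(a ⋇ b)` on `A`. -/
noncomputable def starMul (χ : L →ₗ[k] k) : A ⊗[k] A →ₗ[k] A :=
  (TensorProduct.rid k A).toLinearMap ∘ₗ χ.lTensor A ∘ₗ D.mul

/-- Under `A → A_χ`, the right action of `c ∈ I_χ` becomes `a ↦ a ⋆_χ c`. -/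
lemma starRight_wpLeft (χ : L →ₗ[k] k) (c : invariants D) (a : A) :
    starRight D χ c (wpLeft D χ (ofA D a)) = wpLeft D χ (ofA D (starMul D χ (a ⊗ₜ (c : A)))) := by
  have h1 : starRight D χ c (wpLeft D χ (ofA D a)) = wpLeft D χ (ofA D a * ofA D c) := rfl
  have h2 : ofA D a * ofA D (c : A) = (D.mul (a ⊗ₜ (c : A)) : A ⊗[k] L) := by
    refine (smashMul_tmul D a 1 ((c : A) ⊗ₜ 1)).trans ?_
    rw [leftL_one, Module.End.one_apply, leftA_tmul, rightL_one]
  rw [h1, h2]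
  exact wpLeft_tensor D χ _

/-- The tensor product `A_χ ⊗ _χ'A` over `k` of the induced modules, a `B`-bimodule under
`a.(x ⊗ y).b = (a x) ⊗ (y b)`. -/
def IndTensor (χ χ' : L →ₗ[k] k) : Type _ := LeftInd D χ ⊗[k] RightInd D χ'

variable (χ χ' : L →ₗ[k] k)

noncomputable instance : AddCommGroup (IndTensor D χ χ') :=
  inferInstanceAs (AddCommGroup (LeftInd D χ ⊗[k] RightInd D χ'))

noncomputable instance : Module k (IndTensor D χ χ') :=
  inferInstanceAs (Module k (LeftInd D χ ⊗[k] RightInd D χ'))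

/-- The bilinear map `(x, y) ↦ x ⊗ y`. -/
noncomputable def indTmul : LeftInd D χ →ₗ[k] RightInd D χ' →ₗ[k] IndTensor D χ χ' :=
  TensorProduct.mk k (LeftInd D χ) (RightInd D χ')

lemma IndTensor.induction {p : IndTensor D χ χ' → Prop} (x : IndTensor D χ χ') (h0 : p 0)
    (ht : ∀ x y, p (indTmul D χ χ' x y)) (ha : ∀ x y, p x → p y → p (x + y)) : p x :=
  TensorProduct.induction_on x h0 ht ha

/-- The left action `a.(x ⊗ y) = (a x) ⊗ y`. -/
noncomputable instance : Module (Smash D) (IndTensor D χ χ') where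
  smul a := (Algebra.lsmul k k (LeftInd D χ) a).rTensor (RightInd D χ')
  one_smul x := by
    change (Algebra.lsmul k k (LeftInd D χ) (1 : Smash D)).rTensor (RightInd D χ') x = x
    rw [map_one]; exact LinearMap.rTensor_id_apply _ _ _
  mul_smul a b x := by
    change (Algebra.lsmul k k (LeftInd D χ) (a * b)).rTensor (RightInd D χ') x = _
    rw [map_mul]; exact LinearMap.rTensor_comp_apply _ _ _ _
  smul_zero a := map_zero ((Algebra.lsmul k k (LeftInd D χ) a).rTensor (RightInd D χ'))
  smul_add a := map_add ((Algebra.lsmul k k (LeftInd D χ) a).rTensor (RightInd D χ'))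
  add_smul a b x := by
    change (Algebra.lsmul k k (LeftInd D χ) (a + b)).rTensor (RightInd D χ') x = _
    rw [map_add, LinearMap.rTensor_add]; rfl
  zero_smul x := by
    change (Algebra.lsmul k k (LeftInd D χ) (0 : Smash D)).rTensor (RightInd D χ') x = 0
    rw [map_zero, LinearMap.rTensor_zero]; rfl

/-- The right action `(x ⊗ y).b = x ⊗ (y b)`. -/
noncomputable instance : Module (Smash D)ᵐᵒᵖ (IndTensor D χ χ') where
  smul a := (Algebra.lsmul k k (RightInd D χ') a).lTensor (LeftInd D χ)
  one_smul x := by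
    change (Algebra.lsmul k k (RightInd D χ') (1 : (Smash D)ᵐᵒᵖ)).lTensor (LeftInd D χ) x = x
    rw [map_one]; exact LinearMap.lTensor_id_apply _ _ _
  mul_smul a b x := by
    change (Algebra.lsmul k k (RightInd D χ') (a * b)).lTensor (LeftInd D χ) x = _
    rw [map_mul]; exact LinearMap.lTensor_comp_apply _ _ _ _
  smul_zero a := map_zero ((Algebra.lsmul k k (RightInd D χ') a).lTensor (LeftInd D χ))
  smul_add a := map_add ((Algebra.lsmul k k (RightInd D χ') a).lTensor (LeftInd D χ))
  add_smul a b x := by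
    change (Algebra.lsmul k k (RightInd D χ') (a + b)).lTensor (LeftInd D χ) x = _
    rw [map_add, LinearMap.lTensor_add]; rfl
  zero_smul x := by
    change (Algebra.lsmul k k (RightInd D χ') (0 : (Smash D)ᵐᵒᵖ)).lTensor (LeftInd D χ) x = 0
    rw [map_zero, LinearMap.lTensor_zero]; rfl

lemma smul_indTmul (a : Smash D) (x : LeftInd D χ) (y : RightInd D χ') :
    a • indTmul D χ χ' x y = indTmul D χ χ' (a • x) y := rfl

lemma op_smul_indTmul (a : (Smash D)ᵐᵒᵖ) (x : LeftInd D χ) (y : RightInd D χ') :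
    a • indTmul D χ χ' x y = indTmul D χ χ' x (a • y) := rfl

instance : IsScalarTower k (Smash D) (IndTensor D χ χ') where
  smul_assoc c a x := by
    induction x using IndTensor.induction with
    | h0 => simp
    | ha x y hx hy => simp only [smul_add, hx, hy]
    | ht x y => rw [smul_indTmul, smul_indTmul, smul_assoc, map_smul, LinearMap.smul_apply]

instance : IsScalarTower k (Smash D)ᵐᵒᵖ (IndTensor D χ χ') where
  smul_assoc c a x := by
    induction x using IndTensor.induction with
    | h0 => simp
    | ha x y hx hy => simp only [smul_add, hx, hy]
    | ht x y => rw [op_smul_indTmul, op_smul_indTmul, smul_assoc, map_smul]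

instance : SMulCommClass (Smash D) (Smash D)ᵐᵒᵖ (IndTensor D χ χ') where
  smul_comm a c x := by
    induction x using IndTensor.induction with
    | h0 => simp
    | ha x y hx hy => simp only [smul_add, hx, hy]
    | ht x y => rw [smul_indTmul, op_smul_indTmul, op_smul_indTmul, smul_indTmul]

/-- The relations `x c ⊗ y = x ⊗ c y` for `c ∈ A^H`, whose quotient is the tensor product over
the algebra `I_χ`. -/
noncomputable def balRel : SubBimodule k (Smash D) (IndTensor D χ χ') where
  toSubmodule := Submodule.span k {z | ∃ (c : invariants D) (x : LeftInd D χ) (y : RightInd D χ'),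
    z = indTmul D χ χ' (starRight D χ c x) y - indTmul D χ χ' x (starLeft D χ' c y)}
  left_mem a x hx := by
    refine Submodule.span_induction (p := fun x _ => a • x ∈ Submodule.span k _)
      ?_ ?_ ?_ ?_ hx
    · rintro _ ⟨c, x, y, rfl⟩
      refine Submodule.subset_span ⟨c, a • x, y, ?_⟩
      rw [smul_sub, smul_indTmul, smul_indTmul, LinearMap.map_smul (starRight D χ c)]
    · rw [smul_zero]; exact Submodule.zero_mem _
    · intro x y _ _ hx hy; rw [smul_add]; exact Submodule.add_mem _ hx hy
    · intro c x _ hx; rw [smul_comm]; exact Submodule.smul_mem _ c hx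
  right_mem a x hx := by
    refine Submodule.span_induction (p := fun x _ => MulOpposite.op a • x ∈ Submodule.span k _)
      ?_ ?_ ?_ ?_ hx
    · rintro _ ⟨c, x, y, rfl⟩
      refine Submodule.subset_span ⟨c, x, MulOpposite.op a • y, ?_⟩
      rw [smul_sub, op_smul_indTmul, op_smul_indTmul, LinearMap.map_smul (starLeft D χ' c)]
    · rw [smul_zero]; exact Submodule.zero_mem _
    · intro x y _ _ hx hy; rw [smul_add]; exact Submodule.add_mem _ hx hy
    · intro c x _ hx; rw [smul_comm]; exact Submodule.smul_mem _ c hx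

/-- The `B`-bimodule `A_χ ⊗_{I_χ} _χ̃A`. -/
abbrev BalTensor [Module.Finite k H] (χ : InvariantCharacter β) : Type _ :=
  (balRel D χ.toAlgHom.toLinearMap (chiTilde χ)).Quot

/-- The projection `B ⊗ B → A_χ ⊗ _χ̃A → A_χ ⊗_{I_χ} _χ̃A`. -/
noncomputable def balProj [Module.Finite k H] (χ : InvariantCharacter β) :
    Smash D ⊗[k] Smash D →ₗ[k] BalTensor D χ :=
  (balRel D χ.toAlgHom.toLinearMap (chiTilde χ)).proj ∘ₗ
    TensorProduct.lift ((indTmul D χ.toAlgHom.toLinearMap (chiTilde χ)).compl₁₂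
      (wpLeft D χ.toAlgHom.toLinearMap) (wpRight D (chiTilde χ)))

/-- For a multiplication `m` on the `H`-module `A`, the ordinary Galois map
`A ⊗ A → A ⊗ H^*`, `a ⊗ b ↦ a b^[0] ⊗ b^⟨1⟩`. -/
noncomputable def galoisMap [Module.Finite k H] (act : H →ₐ[k] Module.End k A)
    (m : A ⊗[k] A →ₗ[k] A) : A ⊗[k] A →ₗ[k] A ⊗[k] HDual k H :=
  m.rTensor (HDual k H) ∘ₗ (TensorProduct.assoc k A A (HDual k H)).symm.toLinearMap ∘ₗ
    (dualCoact act).lTensor A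

end Balanced

end DynSmash

/-! Since Γ̌(a ⊗ b) = (a ⊗ 1).b and J_χ is a sub-bimodule, P_χ ∘ Γ̌ is left linear in a and right
linear in b. With `balProj_surjective` this makes any factorization through `BalTensor` unique and a
bimodule map. What has to be proved is that P_χ ∘ Γ̌ kills the three families of relations.

The balancing relation already holds for Γ̌: an invariant c has coaction c ⊗ 1 (`bCoact_invariant`).
For the left relation, bλ ⊗ 1 is congruent to b ⊗ (λ ▸ 1) modulo J_χ, and λ ▸ 1 = χ(λ)1 because ε ∘
γ ∘ ι_χ = χ. For the right relation, (b ⊗ 1).λ = bλ^[0] ⊗ λ^⟨1⟩ is congruent to b ⊗ (λ^[0] ▸ λ^⟨1⟩),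
so everything rests on λ^[0] ▸ λ^⟨1⟩ = χ̃(λ)1, which is `lift_lActDual_dualCoact`.

To see this identity, put S(g) = ι_χ(g ▷ λ) and F = γ ∘ S. The left side evaluated at h is the trace
of g ↦ F(g)h, while χ̃(λ) = tr(S ∘ γ) = tr F. So the claim is that right multiplication by h changes
the trace of F only by the factor ε(h). The Yetter–Drinfeld condition and the invariance of χ give
S(xg) = x⁽¹⁾S(g)γ(x⁽²⁾) (`iota_act`). Consider the operator g ↦ γ(h⁽²⁾)F(h⁽¹⁾g)h⁽³⁾. The covariance
of S shows that it equals ε(h)F; cyclicity of the trace collapses h⁽¹⁾γ(h⁽²⁾) and shows that its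
trace is that of g ↦ F(g)h. This is `trace_mulRight_antipode_comp`.

The isomorphism A ⊗ H^* → A ⊗_χ H^* is inverted by (a ⊗ λ) ⊗ η ↦ a ⊗ (λ ▸ η) (`absorb`), which kills
J_χ because ▸ is an action of L. The last formula holds because the coaction sends A into A ⊗ H^*,
and because products of elements of A stay in A when ⋇ has no component along L. -/

namespace DynSmash

/-! ### Traces of operators covariant under the adjoint action -/

section Trace

variable {k H : Type*} [Field k] [Ring H] [HopfAlgebra k H]

/-- If `S(x g) = x⁽¹⁾ S(g) γ(x⁽²⁾)`, then `S(x⁽¹⁾ g) x⁽²⁾ = x S(g)`. -/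
lemma mul_map_of_adjoint {S : H →ₗ[k] H}
    (hS : ∀ x g, S (x * g) = LinearMap.mul' k H (TensorProduct.map (LinearMap.mulRight k (S g))
      (HopfAlgebra.antipode k) (Coalgebra.comul (R := k) x))) (x g : H) :
    LinearMap.mul' k H ((S ∘ₗ LinearMap.mulRight k g).rTensor H (Coalgebra.comul (R := k) x)) =
      x * S g := by
  -- N(a ⊗ b ⊗ c) = a S(g) γ(b) c. Evaluated on the iterated coproduct of x, one bracketing gives
  -- S(x⁽¹⁾g)x⁽²⁾ and the other, by γ(b⁽¹⁾)b⁽²⁾ = ε(b), gives x S(g).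
  let N : H ⊗[k] (H ⊗[k] H) →ₗ[k] H := LinearMap.mul' k H ∘ₗ
    TensorProduct.map (LinearMap.mulRight k (S g))
      (LinearMap.mul' k H ∘ₗ (HopfAlgebra.antipode k).rTensor H)
  have e1 : ∀ z : H ⊗[k] H, LinearMap.mul' k H ((S ∘ₗ LinearMap.mulRight k g).rTensor H z) =
      N (TensorProduct.assoc k H H H ((Coalgebra.comul (R := k) (A := H)).rTensor H z)) := by
    intro z
    induction z using TensorProduct.induction_on with
    | zero => simp
    | add x y hx hy => simp only [map_add, hx, hy]
    | tmul p q =>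
      simp only [LinearMap.rTensor_tmul, LinearMap.comp_apply, LinearMap.mulRight_apply, hS,
        LinearMap.mul'_apply]
      induction Coalgebra.comul (R := k) p using TensorProduct.induction_on with
      | zero => simp
      | add x y hx hy => simp only [map_add, add_mul, add_tmul, hx, hy]
      | tmul a b => simp [N, mul_assoc]
  have e2 : ∀ z : H ⊗[k] H, N ((Coalgebra.comul (R := k) (A := H)).lTensor H z) =
      TensorProduct.rid k H ((Coalgebra.counit (R := k) (A := H)).lTensor H z) * S g := by
    intro z
    induction z using TensorProduct.induction_on with
    | zero => simp
    | add x y hx hy => simp only [map_add, add_mul, hx, hy]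
    | tmul p q => simp [N, Algebra.algebraMap_eq_smul_one]
  rw [e1, Coalgebra.coassoc_apply, e2, Coalgebra.lTensor_counit_comul]
  simp

/-- If `S(x g) = x⁽¹⁾ S(g) γ(x⁽²⁾)`, then `tr (g ↦ γ(S(g)) h) = ε(h) tr (γ ∘ S)`. -/
lemma trace_mulRight_antipode_comp {S : H →ₗ[k] H}
    (hS : ∀ x g, S (x * g) = LinearMap.mul' k H (TensorProduct.map (LinearMap.mulRight k (S g))
      (HopfAlgebra.antipode k) (Coalgebra.comul (R := k) x))) (h : H) :
    LinearMap.trace k H (LinearMap.mulRight k h ∘ₗ HopfAlgebra.antipode k ∘ₗ S) =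
      Coalgebra.counit (R := k) h * LinearMap.trace k H (HopfAlgebra.antipode k ∘ₗ S) := by
  let F : Module.End k H := HopfAlgebra.antipode k ∘ₗ S
  let R : H →ₗ[k] Module.End k H := (LinearMap.mul k H).flip
  let E : H →ₗ[k] Module.End k H := LinearMap.mul k H
  let M : Module.End k H →ₗ[k] Module.End k H →ₗ[k] Module.End k H := LinearMap.mul k _
  -- T(a ⊗ b ⊗ c) is the operator g ↦ γ(b) F(ag) c. It will be evaluated on the iterated coproduct
  -- of h, once as an operator and once under the trace.
  let T : H ⊗[k] (H ⊗[k] H) →ₗ[k] Module.End k H :=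
    LinearMap.mul' k (Module.End k H) ∘ₗ
      TensorProduct.map (LinearMap.mul' k (Module.End k H) ∘ₗ
          TensorProduct.map (E ∘ₗ HopfAlgebra.antipode k) R)
        (LinearMap.mulLeft k F ∘ₗ E) ∘ₗ (TensorProduct.comm k H (H ⊗[k] H)).toLinearMap
  have hT : ∀ a b c, T (a ⊗ₜ (b ⊗ₜ c)) = E (HopfAlgebra.antipode k b) * R c * (F * E a) := by
    intro a b c; simp [T]
  -- Antimultiplicativity of γ merges γ(b) with γ(S(ag)), so that S(h⁽¹⁾g)h⁽²⁾ = h S(g) can be used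
  -- inside γ.
  have hTg : ∀ a b c g, T (a ⊗ₜ (b ⊗ₜ c)) g = HopfAlgebra.antipode k (S (a * g) * b) * c := by
    intro a b c g
    rw [hT, HopfAlgebra.antipode_mul_antidistrib]
    simp [E, R, F, mul_assoc]
  -- As an operator: γ(S(p⁽¹⁾g)p⁽²⁾)q = γ(p S(g))q = F(g)γ(p)q. For p ⊗ q the coproduct of h this
  -- will be ε(h)F(g).
  have e1 : ∀ z : H ⊗[k] H, ∀ g,
      T (TensorProduct.assoc k H H H ((Coalgebra.comul (R := k) (A := H)).rTensor H z)) g =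
        F g * LinearMap.mul' k H ((HopfAlgebra.antipode k).rTensor H z) := by
    intro z g
    induction z using TensorProduct.induction_on with
    | zero => simp
    | add x y hx hy => simp only [map_add, LinearMap.add_apply, mul_add, hx, hy]
    | tmul p q =>
      have e : ∀ w : H ⊗[k] H, T (TensorProduct.assoc k H H H (w ⊗ₜ q)) g =
          HopfAlgebra.antipode k (LinearMap.mul' k H
            ((S ∘ₗ LinearMap.mulRight k g).rTensor H w)) * q := by
        intro w
        induction w using TensorProduct.induction_on with
        | zero => simp
        | add x y hx hy => simp only [map_add, LinearMap.add_apply, add_tmul, add_mul, hx, hy]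
        | tmul a b => rw [TensorProduct.assoc_tmul, hTg]; simp
      rw [LinearMap.rTensor_tmul, e, mul_map_of_adjoint hS, HopfAlgebra.antipode_mul_antidistrib]
      simp [F, mul_assoc]
  -- Under the trace: cyclicity carries left multiplication by γ(b) to the far right, next to left
  -- multiplication by a, where a γ(b) = p⁽¹⁾γ(p⁽²⁾) collapses to ε(p). Only right multiplication by
  -- q composed with F remains.
  have e2 : ∀ z : H ⊗[k] H, LinearMap.trace k H
      (T (TensorProduct.assoc k H H H ((Coalgebra.comul (R := k) (A := H)).rTensor H z))) =
      LinearMap.trace k H (R (TensorProduct.lid k H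
        ((Coalgebra.counit (R := k) (A := H)).rTensor H z)) * F) := by
    intro z
    induction z using TensorProduct.induction_on with
    | zero => simp
    | add x y hx hy => simp only [map_add, add_mul, hx, hy]
    | tmul p q =>
      have e : ∀ w : H ⊗[k] H, LinearMap.trace k H (T (TensorProduct.assoc k H H H (w ⊗ₜ q))) =
          LinearMap.trace k H (R q * F * E (LinearMap.mul' k H
            ((HopfAlgebra.antipode k).lTensor H w))) := by
        intro w
        induction w using TensorProduct.induction_on with
        | zero => simp
        | add x y hx hy => simp only [map_add, add_tmul, mul_add, hx, hy]
        | tmul a b =>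
          rw [TensorProduct.assoc_tmul, hT, mul_assoc, LinearMap.trace_mul_comm]
          congr 1
          ext g
          simp [E, R, mul_assoc]
      rw [LinearMap.rTensor_tmul, e, HopfAlgebra.mul_antipode_lTensor_comul_apply]
      have hE : E (algebraMap k H (Coalgebra.counit p)) = Coalgebra.counit (R := k) p • 1 := by
        ext g; simp [E, Algebra.algebraMap_eq_smul_one]
      rw [hE]
      simp
  have e3 : T (TensorProduct.assoc k H H H ((Coalgebra.comul (R := k) (A := H)).rTensor H
      (Coalgebra.comul (R := k) h))) = Coalgebra.counit (R := k) h • F := by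
    ext g
    rw [e1, HopfAlgebra.mul_antipode_rTensor_comul_apply]
    simp [Algebra.algebraMap_eq_smul_one]
  have h4 := e2 (Coalgebra.comul (R := k) h)
  rw [e3, Coalgebra.rTensor_counit_comul] at h4
  rw [map_smul, smul_eq_mul, TensorProduct.lid_tmul, one_smul] at h4
  exact h4.symm

end Trace

/-! ### Covariance of ι_χ -/

section Adjoint

variable {k H L : Type*} [Field k] [Ring H] [HopfAlgebra k H] [Ring L] [Algebra k L]
  {β : BaseAlgebra k H L} (χ : InvariantCharacter β)

/-- `ι_χ(x ▷ l) = x⁽¹⁾ ι_χ(l) γ(x⁽²⁾)` -/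
lemma iota_act (x : H) (l : L) : iota χ (β.act x l) =
    LinearMap.mul' k H (TensorProduct.map (LinearMap.mulRight k (iota χ l))
      (HopfAlgebra.antipode k) (Coalgebra.comul (R := k) x)) := by
  -- Applying id ⊗ χ to the right side of the Yetter–Drinfeld condition: invariance of χ replaces
  -- the action of the middle leg by its counit.
  have e : ∀ (w : H ⊗[k] (H ⊗[k] H)) (z : H ⊗[k] L),
      TensorProduct.rid k H (χ.toAlgHom.toLinearMap.lTensor H (ydTwist β.act w z)) =
      LinearMap.mul' k H (TensorProduct.map
        (LinearMap.mulRight k (TensorProduct.rid k H (χ.toAlgHom.toLinearMap.lTensor H z)))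
        (HopfAlgebra.antipode k) (((TensorProduct.lid k H).toLinearMap ∘ₗ
          (Coalgebra.counit (R := k) (A := H)).rTensor H).lTensor H w)) := by
    intro w z
    induction w using TensorProduct.induction_on with
    | zero => simp
    | add x y hx hy => simp only [map_add, LinearMap.add_apply, hx, hy]
    | tmul a w =>
      induction w using TensorProduct.induction_on with
      | zero => simp
      | add x y hx hy => simp only [tmul_add, map_add, LinearMap.add_apply, hx, hy]
      | tmul b c =>
        induction z using TensorProduct.induction_on with
        | zero => simp
        | add x y hx hy =>
          rw [map_add, map_add, map_add, hx, hy]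
          simp [mul_add, add_mul]
        | tmul g n =>
          rw [ydTwist_tmul]
          simp [χ.invariant, mul_smul, mul_assoc]
  have h := e ((Coalgebra.comul (R := k) (A := H)).lTensor H (Coalgebra.comul (R := k) x))
    (β.coact l)
  rw [← β.yetterDrinfeld, ← LinearMap.comp_apply (LinearMap.lTensor H _) (LinearMap.lTensor H _),
    ← LinearMap.lTensor_comp] at h
  -- The counit on the middle leg turns the threefold coproduct of x into the twofold one.
  have e' : ((TensorProduct.lid k H).toLinearMap ∘ₗ
      (Coalgebra.counit (R := k) (A := H)).rTensor H) ∘ₗ Coalgebra.comul = LinearMap.id := by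
    ext y; simp
  rw [e', LinearMap.lTensor_id] at h
  exact h

end Adjoint

/-! ### The adjoint character as a trace, and the action of L on H^* -/

section Theta

variable {k H L : Type*} [Field k] [Ring H] [HopfAlgebra k H] [Module.Finite k H]
  [Ring L] [Algebra k L] {β : BaseAlgebra k H L} (χ : InvariantCharacter β)

/-- Since χ(f ▷ m) = ⟨f, ι_χ(m)⟩, the defining sum over a basis is the trace of g ↦ ι_χ(γ(g) ▷ l).
Cyclicity then moves γ to the outside, the form in which this trace appears in l^[0] ▸ l^⟨1⟩. -/
lemma chiTilde_eq_trace (l : L) : chiTilde χ l = LinearMap.trace k H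
    (HopfAlgebra.antipode k ∘ₗ (iota χ).toLinearMap ∘ₗ β.act.toLinearMap.flip l) := by
  have e : ∀ (f : Module.Dual k H) (m : L), χ.toAlgHom (dualAct β f m) = f (iota χ m) := by
    intro f m
    have : ∀ z : H ⊗[k] L, χ.toAlgHom (TensorProduct.lid k L (f.rTensor L z)) =
        f (TensorProduct.rid k H (χ.toAlgHom.toLinearMap.lTensor H z)) := by
      intro z
      induction z using TensorProduct.induction_on with
      | zero => simp
      | add x y hx hy => simp only [map_add, hx, hy]
      | tmul g n => simp [mul_comm]
    exact this _
  refine Eq.trans ?_ (LinearMap.trace_mul_comm k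
    ((iota χ).toLinearMap ∘ₗ β.act.toLinearMap.flip l) (HopfAlgebra.antipode k))
  rw [LinearMap.trace_eq_matrix_trace k (Module.finBasis k H), Matrix.trace]
  simp [chiTilde, thetaBar, e, LinearMap.toMatrix_apply]

/-- `⟨l ▸ η, h⟩`, for `l ⊗ η ∈ L ⊗ H^*` viewed as a map `H → L`, is a trace. -/
lemma eval_lift_lActDual (z : L ⊗[k] HDual k H) (h : H) :
    HDual.eval (TensorProduct.lift (lActDual χ) z) h = LinearMap.trace k H
      (LinearMap.mulRight k h ∘ₗ HopfAlgebra.antipode k ∘ₗ (iota χ).toLinearMap ∘ₗ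
        dualLinearEquiv k H L z) := by
  induction z using TensorProduct.induction_on with
  | zero => simp
  | add x y hx hy => simp only [map_add, LinearMap.add_apply, LinearMap.comp_add, hx, hy]
  | tmul l η =>
    -- On a pure tensor the operator has rank at most one, g ↦ ⟨η, g⟩ γ(ι_χ(l))h, so its trace is
    -- ⟨η, γ(ι_χ(l))h⟩.
    have e : LinearMap.mulRight k h ∘ₗ HopfAlgebra.antipode k ∘ₗ (iota χ).toLinearMap ∘ₗ
        dualLinearEquiv k H L (l ⊗ₜ η) =
        (HDual.eval η).smulRight (HopfAlgebra.antipode k (iota χ l) * h) := by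
      ext g; simp [dualLinearEquiv_tmul]
    rw [e, LinearMap.trace_smulRight]
    simp [lActDual, coregRight_apply]

/-- `l^[0] ▸ l^⟨1⟩ = χ̃(l)` -/
lemma lift_lActDual_dualCoact (l : L) :
    TensorProduct.lift (lActDual χ) (dualCoact β.act l) = chiTilde χ l • (1 : HDual k H) := by
  apply HDual.ext
  intro h
  have e : dualLinearEquiv k H L (dualCoact β.act l) = β.act.toLinearMap.flip l := by
    ext g; rw [dualLinearEquiv_dualCoact]; rfl
  rw [eval_lift_lActDual, e, chiTilde_eq_trace, map_smul, LinearMap.smul_apply, HDual.eval_one,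
    smul_eq_mul, mul_comm]
  -- S(g) = ι_χ(g ▷ l) satisfies the covariance hypothesis by `iota_act` applied to g ▷ l.
  refine trace_mulRight_antipode_comp (S := (iota χ).toLinearMap ∘ₗ β.act.toLinearMap.flip l)
    (fun x g => ?_) h
  simp [iota_act]

-- A left action results because the right action ↼ is composed with the antimultiplicative γ. This
-- is what lets `absorb` vanish on J_χ.
omit [Module.Finite k H] in
lemma lActDual_mul (l m : L) (η : HDual k H) :
    lActDual χ (l * m) η = lActDual χ l (lActDual χ m η) := by
  apply HDual.ext
  intro h
  simp [lActDual, coregRight_apply, HopfAlgebra.antipode_mul_antidistrib, mul_assoc]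

omit [Module.Finite k H] in
lemma lActDual_one (η : HDual k H) : lActDual χ 1 η = η := by
  apply HDual.ext
  intro h
  simp [lActDual, coregRight_apply]

-- The counit of H undoes the coaction, leaving only χ.
omit [Module.Finite k H] in
lemma counit_iota (l : L) : Coalgebra.counit (R := k) (iota χ l) = χ.toAlgHom l := by
  have e : ∀ z : H ⊗[k] L, Coalgebra.counit (R := k)
      (TensorProduct.rid k H (χ.toAlgHom.toLinearMap.lTensor H z)) =
      χ.toAlgHom (TensorProduct.lid k L ((Coalgebra.counit (R := k) (A := H)).rTensor L z)) := by
    intro z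
    induction z using TensorProduct.induction_on with
    | zero => simp
    | add x y hx hy => simp only [map_add, hx, hy]
    | tmul g n => simp [mul_comm]
  refine (e (β.coact l)).trans ?_
  rw [β.coact_counit]
  simp

-- The unit of H^* is ε, and ε ∘ γ = ε. This is the left-hand counterpart of
-- `lift_lActDual_dualCoact`: it makes the relation bλ = χ(λ)b compatible with J_χ.
omit [Module.Finite k H] in
lemma lActDual_apply_one (l : L) : lActDual χ l (1 : HDual k H) = χ.toAlgHom l • 1 := by
  apply HDual.ext
  intro h
  simp [lActDual, coregRight_apply, HDual.eval_one, counit_iota]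

end Theta

/-! ### The coaction on L, on A and on invariants; linearity of Γ̌ -/

section Coaction

variable {k H L A : Type*} [Field k] [Ring H] [HopfAlgebra k H] [Ring L] [Algebra k L]
  [AddCommGroup A] [Module k A] {β : BaseAlgebra k H L} (D : DynamicalAlgebra β A)

lemma bAct_ofL (h : H) (l : L) : bAct D h (ofL D l) = ofL D (β.act h l) := by
  have e : ∀ z : H ⊗[k] H, TensorProduct.map (D.act.toLinearMap.flip D.one)
      (β.act.toLinearMap.flip l) z = D.one ⊗ₜ[k] (β.act (TensorProduct.lid k H
        ((Coalgebra.counit (R := k) (A := H)).rTensor H z)) l) := by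
    intro z
    induction z using TensorProduct.induction_on with
    | zero => simp
    | add x y hx hy => simp only [map_add, LinearMap.add_apply, tmul_add, hx, hy]
    | tmul p q =>
      -- The identity p ▷ 1 = ε(p)1 is available only in A ⊗ L, after tensoring with 1 ∈ L, so it is
      -- multiplied on the right by q ▷ l.
      have := congrArg (rightL (β.act q l)) (act_one_tmul D p)
      simpa [rightL_tmul, smul_tmul'] using this
  refine (tensorAct_tmul D.act β.act h D.one l).trans ((e _).trans ?_)
  rw [Coalgebra.rTensor_counit_comul, TensorProduct.lid_tmul, one_smul]
  rfl

lemma bAct_ofA (h : H) (a : A) : bAct D h (ofA D a) = ofA D (D.act h a) := by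
  have e : ∀ z : H ⊗[k] H, TensorProduct.map (D.act.toLinearMap.flip a)
      (β.act.toLinearMap.flip 1) z = (D.act (TensorProduct.rid k H
        ((Coalgebra.counit (R := k) (A := H)).lTensor H z)) a) ⊗ₜ[k] (1 : L) := by
    intro z
    induction z using TensorProduct.induction_on with
    | zero => simp
    | add x y hx hy => simp only [map_add, LinearMap.add_apply, add_tmul, hx, hy]
    | tmul p q => simp [β.act_one, smul_tmul]
  refine (tensorAct_tmul D.act β.act h a 1).trans ((e _).trans ?_)
  rw [Coalgebra.lTensor_counit_comul, TensorProduct.rid_tmul, one_smul]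
  rfl

variable [Module.Finite k H]

/-- The coaction dual to a module structure is natural in equivariant maps. -/
lemma rTensor_dualCoact {V W : Type*} [AddCommGroup V] [Module k V] [AddCommGroup W] [Module k W]
    {ρ : H →ₐ[k] Module.End k V} {σ : H →ₐ[k] Module.End k W} {f : V →ₗ[k] W}
    (hf : ∀ h v, σ h (f v) = f (ρ h v)) (v : V) :
    dualCoact σ (f v) = f.rTensor (HDual k H) (dualCoact ρ v) := by
  apply (dualLinearEquiv k H W).injective
  ext h
  have e : ∀ z : V ⊗[k] HDual k H, dualLinearEquiv k H W (f.rTensor (HDual k H) z) h =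
      f (dualLinearEquiv k H V z h) := by
    intro z
    induction z using TensorProduct.induction_on with
    | zero => simp
    | add x y hx hy => simp only [map_add, LinearMap.add_apply, hx, hy]
    | tmul v η => simp [dualLinearEquiv_tmul]
  rw [e, dualLinearEquiv_dualCoact, dualLinearEquiv_dualCoact, hf]

lemma bCoact_ofL (l : L) :
    bCoact D (ofL D l) = (ofL D).rTensor (HDual k H) (dualCoact β.act l) :=
  rTensor_dualCoact (bAct_ofL D) l

lemma bCoact_ofA (a : A) :
    bCoact D (ofA D a) = (ofA D).rTensor (HDual k H) (dualCoact D.act a) :=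
  rTensor_dualCoact (bAct_ofA D) a

lemma bCoact_invariant (c : invariants D) : bCoact D (ofA D (c : A)) = ofA D (c : A) ⊗ₜ 1 := by
  apply (dualLinearEquiv k H (Smash D)).injective
  ext h
  rw [dualLinearEquiv_bCoact, bAct_ofA, c.2 h, dualLinearEquiv_tmul, HDual.eval_one, map_smul]

lemma checkGamma_tmul (a b : Smash D) :
    checkGamma D (a ⊗ₜ b) = SmashDual.of D ((a ⊗ₜ 1) * bCoact D b) := by
  simp [checkGamma]

/-- In this form relations in the left factor can be checked on a ⊗ 1, before acting by b, because
P_χ respects the right action. -/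
lemma checkGamma_tmul_eq_op_smul (a b : Smash D) :
    checkGamma D (a ⊗ₜ b) = MulOpposite.op b • SmashDual.of D (a ⊗ₜ 1) :=
  checkGamma_tmul D a b

lemma checkGamma_mul_left (a b c : Smash D) :
    checkGamma D ((a * b) ⊗ₜ c) = a • checkGamma D (b ⊗ₜ c) := by
  rw [checkGamma_tmul, checkGamma_tmul, smul_of, ← mul_assoc,
    Algebra.TensorProduct.tmul_mul_tmul, mul_one]

lemma checkGamma_mul_right (a b c : Smash D) :
    checkGamma D (a ⊗ₜ (b * c)) = MulOpposite.op c • checkGamma D (a ⊗ₜ b) := by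
  rw [checkGamma_tmul, checkGamma_tmul, op_smul_of, map_mul (bCoact D), mul_assoc]

end Coaction

/-! ### The three families of relations -/

section Projection

variable {k H L A : Type*} [Field k] [Ring H] [HopfAlgebra k H] [Module.Finite k H]
  [Ring L] [Algebra k L] [AddCommGroup A] [Module k A] {β : BaseAlgebra k H L}
  (D : DynamicalAlgebra β A) (χ : InvariantCharacter β)

lemma proj_mul_ofL (b : Smash D) (l : L) (η : HDual k H) :
    (subJ D χ).proj (SmashDual.of D ((b * ofL D l) ⊗ₜ η)) =
      (subJ D χ).proj (SmashDual.of D (b ⊗ₜ lActDual χ l η)) := by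
  rw [← sub_eq_zero, ← map_sub, ← map_sub]
  exact (Submodule.Quotient.mk_eq_zero _).2 (Submodule.subset_span ⟨b, l, η, rfl⟩)

/-- Modulo J_χ the element l crosses to H^* and acts on the unit, where it becomes χ(l) by
`lActDual_apply_one`; the right action of y is applied afterwards. -/
lemma proj_checkGamma_mul_ofL (b y : Smash D) (l : L) :
    (subJ D χ).proj (checkGamma D ((b * ofL D l) ⊗ₜ y)) =
      χ.toAlgHom l • (subJ D χ).proj (checkGamma D (b ⊗ₜ y)) := by
  rw [checkGamma_tmul_eq_op_smul, SubBimodule.proj_op_smul, proj_mul_ofL, lActDual_apply_one,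
    tmul_smul, map_smul, ← SubBimodule.proj_op_smul, smul_comm, map_smul,
    ← checkGamma_tmul_eq_op_smul]

/-- This is the relation that forces the adjoint character: the coaction of l stays in L ⊗ H^*, and
modulo J_χ its L-leg acts on its H^*-leg, producing l^[0] ▸ l^⟨1⟩ = χ̃(l)1. -/
lemma proj_checkGamma_ofL_mul (b y : Smash D) (l : L) :
    (subJ D χ).proj (checkGamma D (b ⊗ₜ (ofL D l * y))) =
      chiTilde χ l • (subJ D χ).proj (checkGamma D (b ⊗ₜ y)) := by
  have e : ∀ z : L ⊗[k] HDual k H,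
      (subJ D χ).proj (SmashDual.of D ((b ⊗ₜ 1) * (ofL D).rTensor (HDual k H) z)) =
      (subJ D χ).proj (SmashDual.of D (b ⊗ₜ TensorProduct.lift (lActDual χ) z)) := by
    intro z
    induction z using TensorProduct.induction_on with
    | zero => simp
    | add x y hx hy => simp only [map_add, mul_add, tmul_add, hx, hy]
    | tmul m η => simpa using proj_mul_ofL D χ b m η
  rw [checkGamma_mul_right, SubBimodule.proj_op_smul, checkGamma_tmul, bCoact_ofL, e,
    lift_lActDual_dualCoact, tmul_smul, map_smul, ← SubBimodule.proj_op_smul, smul_comm,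
    map_smul, ← checkGamma_tmul_eq_op_smul]

/-- The coaction of c is c ⊗ 1, so both sides are (xc ⊗ 1) times the coaction of y; no passage to
the quotient is needed. -/
lemma checkGamma_balanced (c : invariants D) (x y : Smash D) :
    checkGamma D ((x * ofA D c) ⊗ₜ y) = checkGamma D (x ⊗ₜ (ofA D c * y)) := by
  rw [checkGamma_tmul, checkGamma_tmul, map_mul (bCoact D), bCoact_invariant, ← mul_assoc,
    Algebra.TensorProduct.tmul_mul_tmul, mul_one]

end Projection

/-- A linear map vanishing on the kernel of a surjection factors through it. -/
lemma exists_comp_eq_of_surjective {k U V W : Type*} [Field k] [AddCommGroup U] [Module k U]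
    [AddCommGroup V] [Module k V] [AddCommGroup W] [Module k W] {p : U →ₗ[k] V}
    (hp : Function.Surjective p) (f : U →ₗ[k] W) (hf : ∀ x, p x = 0 → f x = 0) :
    ∃ g : V →ₗ[k] W, ∀ x, g (p x) = f x := by
  -- Over a field p has a linear section s, and f ∘ s is the factorization: s(p(x)) and x differ by
  -- an element of the kernel of p.
  obtain ⟨s, hs⟩ := p.exists_rightInverse_of_surjective (LinearMap.range_eq_top.2 hp)
  refine ⟨f ∘ₗ s, fun x => ?_⟩
  have h := hf (s (p x) - x) (by
    rw [map_sub, ← LinearMap.comp_apply, hs, LinearMap.id_apply, sub_self])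
  rwa [map_sub, sub_eq_zero] at h

/-! ### Descent to A_χ ⊗_{I_χ} _χ̃A -/

section Descent

variable {k H L A : Type*} [Field k] [Ring H] [HopfAlgebra k H] [Module.Finite k H]
  [Ring L] [Algebra k L] [AddCommGroup A] [Module k A] {β : BaseAlgebra k H L}
  (D : DynamicalAlgebra β A) (χ : InvariantCharacter β)

/-- The bilinear map `(a, b) ↦ P_χ(Γ̌(a ⊗ b))`. -/
noncomputable def projCheckGamma : Smash D →ₗ[k] Smash D →ₗ[k] TwistedDual D χ :=
  TensorProduct.curry ((subJ D χ).proj ∘ₗ checkGamma D)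

lemma projCheckGamma_apply (a b : Smash D) :
    projCheckGamma D χ a b = (subJ D χ).proj (checkGamma D (a ⊗ₜ b)) := rfl

lemma projCheckGamma_of_wpLeft_eq_zero (x : Smash D)
    (hx : wpLeft D χ.toAlgHom.toLinearMap x = 0) : projCheckGamma D χ x = 0 := by
  have hx : x ∈ leftRel D χ.toAlgHom.toLinearMap := (Submodule.Quotient.mk_eq_zero _).1 hx
  ext y
  refine Submodule.span_induction (p := fun x _ => projCheckGamma D χ x y = 0) ?_ ?_ ?_ ?_ hx
  · rintro _ ⟨b, l, rfl⟩
    rw [map_sub, map_smul, LinearMap.sub_apply, LinearMap.smul_apply, sub_eq_zero]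
    exact proj_checkGamma_mul_ofL D χ b y l
  · rw [map_zero, LinearMap.zero_apply]
  · intro x y _ _ hx hy
    rw [map_add, LinearMap.add_apply, hx, hy, add_zero]
  -- The relations are generated as a left B-module, so vanishing must propagate under left
  -- multiplication; left linearity of P_χ ∘ Γ̌ provides this.
  · intro b x _ hx
    rw [projCheckGamma_apply] at hx ⊢
    rw [smul_eq_mul, checkGamma_mul_left, SubBimodule.proj_smul, hx, smul_zero]

lemma projCheckGamma_of_wpRight_eq_zero (x : Smash D) (y : Smash D)
    (hy : wpRight D (chiTilde χ) y = 0) : projCheckGamma D χ x y = 0 := by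
  have hy : y ∈ rightRel D (chiTilde χ) := (Submodule.Quotient.mk_eq_zero _).1 hy
  refine Submodule.span_induction (p := fun y _ => projCheckGamma D χ x y = 0) ?_ ?_ ?_ ?_ hy
  · rintro _ ⟨b, l, rfl⟩
    rw [map_sub, map_smul, sub_eq_zero]
    exact proj_checkGamma_ofL_mul D χ x b l
  · rw [map_zero]
  · intro x y _ _ hx hy
    rw [map_add, hx, hy, add_zero]
  -- Here the relations form a right B-module, and right linearity plays the same role.
  · intro b y _ hy
    rw [projCheckGamma_apply] at hy ⊢
    induction b using MulOpposite.rec' with | _ b =>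
    change (subJ D χ).proj (checkGamma D (x ⊗ₜ (y * b))) = 0
    rw [checkGamma_mul_right, SubBimodule.proj_op_smul, hy, smul_zero]

lemma balProj_tmul (a b : Smash D) : balProj D χ (a ⊗ₜ b) =
    (balRel D χ.toAlgHom.toLinearMap (chiTilde χ)).proj
      (indTmul D χ.toAlgHom.toLinearMap (chiTilde χ)
        (wpLeft D χ.toAlgHom.toLinearMap a) (wpRight D (chiTilde χ) b)) := by
  simp [balProj]

lemma balProj_surjective : Function.Surjective (balProj D χ) := by
  intro z
  obtain ⟨z, rfl⟩ := SubBimodule.proj_surjective _ z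
  induction z using IndTensor.induction with
  | h0 => exact ⟨0, by simp⟩
  | ha x y hx hy =>
    obtain ⟨a, ha⟩ := hx
    obtain ⟨b, hb⟩ := hy
    exact ⟨a + b, by rw [map_add, map_add, ha, hb]⟩
  | ht x y =>
    obtain ⟨a, rfl⟩ := wpLeft_surjective D _ x
    obtain ⟨b, rfl⟩ := wpRight_surjective D _ y
    exact ⟨a ⊗ₜ b, balProj_tmul D χ a b⟩

/-- `P_χ ∘ Γ̌` factors through `A_χ ⊗_{I_χ} _χ̃A`. -/
lemma exists_gamma : ∃ Γ : BalTensor D χ →ₗ[k] TwistedDual D χ,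
    ∀ x, Γ (balProj D χ x) = (subJ D χ).proj (checkGamma D x) := by
  -- The bilinear map descends one variable at a time: g is defined on A_χ × B, then f, obtained
  -- from g with its arguments exchanged, on _χ̃A × A_χ.
  obtain ⟨g, hg⟩ := exists_comp_eq_of_surjective (wpLeft_surjective D _) (projCheckGamma D χ)
    (projCheckGamma_of_wpLeft_eq_zero D χ)
  obtain ⟨f, hf⟩ := exists_comp_eq_of_surjective (wpRight_surjective D (chiTilde χ)) g.flip
    (fun y hy => by
      ext x
      obtain ⟨x, rfl⟩ := wpLeft_surjective D _ x
      rw [LinearMap.flip_apply, hg, LinearMap.zero_apply]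
      exact projCheckGamma_of_wpRight_eq_zero D χ x y hy)
  let G : IndTensor D χ.toAlgHom.toLinearMap (chiTilde χ) →ₗ[k] TwistedDual D χ :=
    TensorProduct.lift f.flip
  have hG : ∀ a b, G (indTmul D _ _ (wpLeft D _ a) (wpRight D _ b)) =
      (subJ D χ).proj (checkGamma D (a ⊗ₜ b)) := by
    intro a b
    refine (TensorProduct.lift.tmul _ _).trans ?_
    rw [LinearMap.flip_apply, hf, LinearMap.flip_apply, hg, projCheckGamma_apply]
  have hle : (balRel D χ.toAlgHom.toLinearMap (chiTilde χ)).toSubmodule ≤ LinearMap.ker G := by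
    refine Submodule.span_le.2 ?_
    rintro _ ⟨c, x, y, rfl⟩
    obtain ⟨x, rfl⟩ := wpLeft_surjective D _ x
    obtain ⟨y, rfl⟩ := wpRight_surjective D _ y
    -- On classes of elements of B both actions of c are multiplication in B, which reduces the
    -- balancing relation to `checkGamma_balanced`.
    have h1 : starRight D χ.toAlgHom.toLinearMap c (wpLeft D _ x) =
        wpLeft D _ (x * ofA D c) := rfl
    have h2 : starLeft D (chiTilde χ) c (wpRight D _ y) = wpRight D _ (ofA D c * y) := rfl
    change G _ = 0
    rw [map_sub, h1, h2, hG, hG, checkGamma_balanced, sub_self]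
  let Γ : BalTensor D χ →ₗ[k] TwistedDual D χ := Submodule.liftQ _ G hle
  refine ⟨Γ, fun x => ?_⟩
  induction x using TensorProduct.induction_on with
  | zero => simp
  | add x y hx hy => simp only [map_add, hx, hy]
  | tmul a b =>
    rw [balProj_tmul]
    exact hG a b

/-- Every element comes from B ⊗ B, where the actions are multiplication on the outer sides;
linearity of Γ is thus inherited from that of P_χ ∘ Γ̌. -/
lemma isBimoduleHom_of_comp_balProj {Γ : BalTensor D χ →ₗ[k] TwistedDual D χ}
    (hΓ : ∀ x, Γ (balProj D χ x) = (subJ D χ).proj (checkGamma D x)) :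
    IsBimoduleHom (B := Smash D) Γ := by
  constructor
  · intro b x
    obtain ⟨x, rfl⟩ := balProj_surjective D χ x
    induction x using TensorProduct.induction_on with
    | zero => simp
    | add x y hx hy => simp only [map_add, smul_add, hx, hy]
    | tmul a c =>
      have h : b • balProj D χ (a ⊗ₜ c) = balProj D χ ((b * a) ⊗ₜ c) := by
        rw [balProj_tmul, balProj_tmul, ← SubBimodule.proj_smul, smul_indTmul, wpLeft_mul]
      rw [h, hΓ, hΓ, checkGamma_mul_left, SubBimodule.proj_smul]
  · intro b x
    obtain ⟨x, rfl⟩ := balProj_surjective D χ x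
    induction x using TensorProduct.induction_on with
    | zero => simp
    | add x y hx hy => simp only [map_add, smul_add, hx, hy]
    | tmul a c =>
      have h : MulOpposite.op b • balProj D χ (a ⊗ₜ c) = balProj D χ (a ⊗ₜ (c * b)) := by
        rw [balProj_tmul, balProj_tmul, ← SubBimodule.proj_op_smul, op_smul_indTmul, wpRight_mul]
      rw [h, hΓ, hΓ, checkGamma_mul_right, SubBimodule.proj_op_smul]

end Descent

/-! ### The identification of A ⊗_χ H^* with A ⊗ H^* -/

section Target

variable {k H L A : Type*} [Field k] [Ring H] [HopfAlgebra k H] [Module.Finite k H]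
  [Ring L] [Algebra k L] [AddCommGroup A] [Module k A] {β : BaseAlgebra k H L}
  (D : DynamicalAlgebra β A) (χ : InvariantCharacter β)

/-- The map `B ⊗ H^* → A ⊗ H^*`, `(a ⊗ l) ⊗ η ↦ a ⊗ (l ▸ η)`. -/
noncomputable def absorb : (A ⊗[k] L) ⊗[k] HDual k H →ₗ[k] A ⊗[k] HDual k H :=
  (TensorProduct.lift (lActDual χ)).lTensor A ∘ₗ
    (TensorProduct.assoc k A L (HDual k H)).toLinearMap

omit [Module.Finite k H] in
lemma absorb_tmul (a : A) (l : L) (η : HDual k H) :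
    absorb χ ((a ⊗ₜ[k] l) ⊗ₜ[k] η) = a ⊗ₜ lActDual χ l η := by
  simp [absorb]

omit [Module.Finite k H] in
-- Multiplicativity of ▸ says that `absorb` takes equal values on the two terms of each generator of
-- J_χ.
lemma absorb_rightL (x : A ⊗[k] L) (l : L) (η : HDual k H) :
    absorb χ (rightL l x ⊗ₜ[k] η) = absorb χ (x ⊗ₜ[k] lActDual χ l η) := by
  induction x using TensorProduct.induction_on with
  | zero => simp
  | add x y hx hy => simp only [map_add, add_tmul, hx, hy]
  | tmul a m => rw [rightL_tmul, absorb_tmul, absorb_tmul, lActDual_mul]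

lemma toTwistedDual_injective : Function.Injective (toTwistedDual D χ) := by
  rw [injective_iff_map_eq_zero]
  intro x hx
  have hx : SmashDual.of D ((ofA D).rTensor (HDual k H) x) ∈ (subJ D χ).toSubmodule :=
    (Submodule.Quotient.mk_eq_zero _).1 hx
  -- Q kills J_χ and restricts to the identity on A ⊗ H^*, since 1 ∈ L acts trivially; hence A ⊗ H^*
  -- meets J_χ only in 0.
  let Q : SmashDual D →ₗ[k] A ⊗[k] HDual k H := absorb χ
  have hJ : (subJ D χ).toSubmodule ≤ LinearMap.ker Q := by
    refine Submodule.span_le.2 ?_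
    rintro _ ⟨b, l, η, rfl⟩
    refine LinearMap.mem_ker.2 ?_
    rw [map_sub, map_sub, mul_ofL, sub_eq_zero]
    exact absorb_rightL χ b l η
  have hQ : ∀ x, Q (SmashDual.of D ((ofA D).rTensor (HDual k H) x)) = x := by
    intro x
    induction x using TensorProduct.induction_on with
    | zero => simp
    | add x y hx hy => simp only [map_add, hx, hy]
    | tmul a η => exact (absorb_tmul χ a 1 η).trans (by rw [lActDual_one])
  rw [← hQ x]
  exact hJ hx

lemma toTwistedDual_surjective : Function.Surjective (toTwistedDual D χ) := by
  -- Every x is congruent to the image of `absorb χ x` modulo J_χ: on (a ⊗ l) ⊗ η, which is al ⊗ η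
  -- in B ⊗ H^*, this is the defining relation of J_χ.
  have e : ∀ x : (A ⊗[k] L) ⊗[k] HDual k H,
      toTwistedDual D χ (absorb χ x) = (subJ D χ).proj (SmashDual.of D x) := by
    intro x
    induction x using TensorProduct.induction_on with
    | zero => simp; rfl
    | add x y hx hy =>
      rw [map_add, map_add, hx, hy]
      exact (map_add ((subJ D χ).proj ∘ₗ (SmashDual.of D).toLinearMap) _ _).symm
    | tmul x η =>
      induction x using TensorProduct.induction_on with
      | zero => simp; rfl
      | add x y hx hy =>
        rw [add_tmul, map_add, map_add, hx, hy]
        exact (map_add ((subJ D χ).proj ∘ₗ (SmashDual.of D).toLinearMap) _ _).symm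
      | tmul a l =>
        have h : ofA D a * ofL D l = (a ⊗ₜ[k] l : A ⊗[k] L) := by
          refine (mul_ofL D (ofA D a) l).trans ((rightL_tmul l a 1).trans ?_)
          rw [_root_.one_mul]
        rw [absorb_tmul]
        refine (proj_mul_ofL D χ (ofA D a) l η).symm.trans ?_
        rw [h]
        rfl
  intro z
  obtain ⟨z, rfl⟩ := SubBimodule.proj_surjective _ z
  exact ⟨_, e z⟩

/-- If `a ⋇ b = a b ⊗ 1`, then `Γ̌` restricts to the ordinary Galois map on `A ⊗ A`. -/
lemma checkGamma_ofA {m : A ⊗[k] A →ₗ[k] A} (hm : ∀ x, D.mul x = m x ⊗ₜ[k] (1 : L))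
    (x : A ⊗[k] A) : checkGamma D (TensorProduct.map (ofA D) (ofA D) x) =
      SmashDual.of D ((ofA D).rTensor (HDual k H) (galoisMap D.act m x)) := by
  -- With no component of ⋇ along L, the subspace A of B is closed under multiplication, with
  -- product m.
  have h : ∀ a b, ofA D a * ofA D b = ofA D (m (a ⊗ₜ b)) := by
    intro a b
    refine (smashMul_tmul D a 1 (b ⊗ₜ 1)).trans ?_
    rw [leftL_one, Module.End.one_apply, leftA_tmul, rightL_one, hm]
    rfl
  induction x using TensorProduct.induction_on with
  | zero => simp
  | add x y hx hy => simp only [map_add, hx, hy]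
  | tmul a b =>
    rw [TensorProduct.map_tmul, checkGamma_tmul, bCoact_ofA]
    simp only [galoisMap, LinearMap.comp_apply, LinearMap.lTensor_tmul, LinearEquiv.coe_coe]
    congr 1
    induction dualCoact D.act b using TensorProduct.induction_on with
    | zero => simp
    | add x y hx hy => simp only [map_add, mul_add, tmul_add, hx, hy]
    | tmul c η => simp [h]

end Target

end DynSmash

/-! ### The theorem -/

theorem mainTheorem2 {k H L A : Type*} [Field k] [Ring H] [HopfAlgebra k H] [Module.Finite k H]
    [Ring L] [Algebra k L] (β : DynSmash.BaseAlgebra k H L) [AddCommGroup A] [Module k A]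
    (D : DynSmash.DynamicalAlgebra β A) (χ : DynSmash.InvariantCharacter β) :
    ∃ Γ : DynSmash.BalTensor D χ →ₗ[k] DynSmash.TwistedDual D χ,
      DynSmash.IsBimoduleHom (B := DynSmash.Smash D) Γ ∧
      (∀ x : DynSmash.Smash D ⊗[k] DynSmash.Smash D,
        Γ (DynSmash.balProj D χ x) = (DynSmash.subJ D χ).proj (DynSmash.checkGamma D x)) ∧
      (∀ Γ' : DynSmash.BalTensor D χ →ₗ[k] DynSmash.TwistedDual D χ,
        (∀ x : DynSmash.Smash D ⊗[k] DynSmash.Smash D,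
          Γ' (DynSmash.balProj D χ x) = (DynSmash.subJ D χ).proj (DynSmash.checkGamma D x)) →
        Γ' = Γ) ∧
      Function.Bijective (DynSmash.toTwistedDual D χ) ∧
      (∀ m : A ⊗[k] A →ₗ[k] A, (∀ x : A ⊗[k] A, D.mul x = m x ⊗ₜ[k] (1 : L)) →
        ∀ x : A ⊗[k] A,
          Γ (DynSmash.balProj D χ (TensorProduct.map (DynSmash.ofA D) (DynSmash.ofA D) x)) =
            DynSmash.toTwistedDual D χ (DynSmash.galoisMap D.act m x)) := by
  obtain ⟨Γ, hΓ⟩ := DynSmash.exists_gamma D χ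
  refine ⟨Γ, DynSmash.isBimoduleHom_of_comp_balProj D χ hΓ, hΓ, fun Γ' h' => ?_,
    ⟨DynSmash.toTwistedDual_injective D χ, DynSmash.toTwistedDual_surjective D χ⟩,
    fun m hm x => ?_⟩
  · ext x
    obtain ⟨x, rfl⟩ := DynSmash.balProj_surjective D χ x
    rw [h', hΓ]
  · rw [hΓ, DynSmash.checkGamma_ofA D hm]
    rfl
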